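/- Let $\ell$ be a prime number and let $K$ be a complete discrete valuation field of characteristic zero and residue characteristic $\ell$, with valuation ring $\mathcal{O}_K$ and normalized valuation $v : K^\times \twoheadrightarrow \mathbf{Z}$; put $e = v(\ell)$. Let $G$ be a finite group satisfying $(D_\ell)$, that is, $G$ has a normal subgroup $N$ of order prime to $\ell$ such that $G/N$ is a cyclic $\ell$-group, and suppose that the group algebra $K[N]$ is quasisplit, i.e. semisimple and isomorphic to a direct sum of matrix algebras over commutative fields. Let $V$ be a $2d$-dimensional $K$-vector space which is a faithful simple symplectic $K[G]$-module: $G$ acts $K$-linearly and faithfully on $V$, $V$ is simple as a $K[G]$-module, and there is a nondegenerate alternating $G$-invariant $K$-bilinear form $V \times V \to K$. Suppose $\ell > de + 1$. Then there exist a $G$-stable $\mathcal{O}_K$-lattice $T$ in $V$ and a perfect alternating $G$-invariant $\mathcal{O}_K$-bilinear form $$f' : T \times T \to \mathcal{O}_K,$$ where perfect means that both natural maps $T \to \mathrm{Hom}_{\mathcal{O}_K}(T, \mathcal{O}_K)$ induced by $f'$ are bijective. -/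

import Mathlib

open scoped WithZero

/-- The finite group `G` satisfies the condition `(D_ℓ)` by way of its normal subgroup `N`: `ℓ` is a
prime number, `N` has order prime to `ℓ`, and `G ⧸ N` is a cyclic `ℓ`-group. -/
structure SatisfiesDVia (ℓ : ℕ) (G : Type*) [Group G] (N : Subgroup G) [N.Normal] : Prop where
  prime : ℓ.Prime
  finite : Finite G
  coprime : (Nat.card N).Coprime ℓ
  isCyclic : IsCyclic (G ⧸ N)
  isPGroup : IsPGroup ℓ (G ⧸ N)

/-- A semisimple `K`-algebra is quasisplit if it is a (finite) direct sum of matrix algebras over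
commutative fields. (These fields are isomorphic to the centres of the simple blocks of `A`, so it
is no restriction to take them in the universe of `A`.) -/
def IsQuasisplit.{u, w} (K : Type u) [Field K] (A : Type w) [Ring A] [Algebra K A] : Prop :=
  IsSemisimpleRing A ∧
    ∃ (n : ℕ) (F : Fin n → Type w) (d : Fin n → ℕ) (_ : ∀ i, Field (F i))
      (_ : ∀ i, Algebra K (F i)),
      (∀ i, NeZero (d i)) ∧ Nonempty (A ≃ₐ[K] Π i, Matrix (Fin (d i)) (Fin (d i)) (F i))

/-- The representation `ρ` makes `V` a symplectic `K[G]`-module: there is a nondegenerate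
alternating `G`-invariant `K`-bilinear form on `V`. -/
def IsSymplecticRep {K G V : Type*} [Field K] [Group G] [AddCommGroup V] [Module K V]
    (ρ : Representation K G V) : Prop :=
  ∃ f : LinearMap.BilinForm K V, f.Nondegenerate ∧ f.IsAlt ∧
    ∀ (g : G) (x y : V), f (ρ g x) (ρ g y) = f x y

/-!
The lattice `T` is found by comparing a stable lattice with its dual: whenever the lattices under
consideration form a single chain `u ^ i • T`, the dual of `T` is `u ^ c • T` for some `c`, and one
tries to absorb this power of `u`.

As `ℓ ∤ dim V` and `K[N]` is quasisplit, `V` is isotypic over `N` and the image of `K[N]` in `End V`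
is a matrix algebra over a field `F`. A generator `γ` of `G` modulo `N` normalizes it, and fixes its
centre `F` because `ℓ ∤ [F : K]`; by Skolem-Noether and the extraction of an `ℓ`-power root of an
element of `F`, it acts on `V` as `x β`, where `x` comes from `K[N]`, and `β` commutes with `G` and
has `ℓ`-power order.

* If `β = 1`, then `V` is irreducible over `N`. Since `|N|` is a unit of `O`, a stable lattice stays
  irreducible modulo `ϖ`: otherwise an idempotent could be lifted. So the `N`-stable lattices are
  the `ϖ ^ i • T`, and it suffices to multiply the form by a power of `ϖ`.
* If `β ≠ 1`, then `End_G V` contains a field `L` with a primitive `ℓ`-th root of unity `ζ`. Put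
  `u = ζ - ζ⁻¹` and let `T` be stable under `G` and `ζ`. As `u ^ (ℓ - 1)` is associated to `ℓ`, the
  `(ℓ - 1)`-st power of `det (u | T)` has valuation `2de < 2(ℓ - 1)`, so `det (u | T)` is a
  uniformizer and the `u`-stable lattices are the `u ^ i • T`. This forces `dim_L V = 1`, so `G`
  acts through `Lˣ` and `ζ` may be taken in the image of `G`. Then `u` is skew-adjoint for the form,
  the dual of `T` is `u ^ (2 * s) • T` for some `s` since the form is alternating, and `u ^ s • T`
  is self-dual.
-/

open scoped Pointwise

section Lattices

variable {O K V : Type*} [CommRing O] [Field K] [Algebra O K] [AddCommGroup V] [Module K V]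
  [Module O V] [IsScalarTower O K V]

variable (K) in
theorem exists_smul_le [IsFractionRing O K] {S : Submodule O V} (hS : S.FG)
    (T : Submodule O V) [hT : T.IsLattice K] : ∃ a : nonZeroDivisors O, (a : O) • S ≤ T := by
  have hvec (x : V) : ∃ a : nonZeroDivisors O, (a : O) • x ∈ T := by
    have hx : x ∈ Submodule.span K (T : Set V) := hT.span_eq_top ▸ Submodule.mem_top
    induction hx using Submodule.span_induction with
    | mem x hx => exact ⟨1, by simpa using hx⟩
    | zero => exact ⟨1, by simp⟩
    | add x y _ _ hx hy =>
      obtain ⟨a, ha⟩ := hx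
      obtain ⟨b, hb⟩ := hy
      refine ⟨a * b, ?_⟩
      rw [smul_add, Submonoid.coe_mul]
      nth_rw 1 [mul_comm]
      simpa only [mul_smul] using add_mem (T.smul_mem (b : O) ha) (T.smul_mem (a : O) hb)
    | smul c x _ hx =>
      obtain ⟨a, ha⟩ := hx
      obtain ⟨r, b, rfl⟩ := IsLocalization.exists_mk'_eq (nonZeroDivisors O) c
      refine ⟨a * b, ?_⟩
      rw [Submonoid.coe_mul, mul_smul, ← smul_assoc (b : O), IsLocalization.smul_mk'_self,
        algebraMap_smul, smul_comm]
      exact T.smul_mem r ha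
  classical
  obtain ⟨s, rfl⟩ := hS
  choose a ha using hvec
  refine ⟨∏ x ∈ s, a x, ?_⟩
  rw [Submodule.smul_span, Submodule.span_le]
  rintro _ ⟨x, hx, rfl⟩
  change ((∏ x ∈ s, a x : nonZeroDivisors O) : O) • x ∈ T
  rw [← Finset.prod_erase_mul s a hx, Submonoid.coe_mul]
  simpa only [mul_smul] using T.smul_mem _ (ha x)

variable (K) in
theorem le_of_smul_le_smul_of_ne_zero [IsDomain O] [IsFractionRing O K] {a : O} (ha : a ≠ 0)
    {S T : Submodule O V} (h : a • S ≤ a • T) : S ≤ T := by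
  have := Module.IsTorsionFree.trans_faithfulSMul O K V
  intro x hx
  obtain ⟨y, hy, hyx⟩ := h (Submodule.smul_mem_pointwise_smul x a S hx)
  exact smul_right_injective V ha hyx ▸ hy

end Lattices

section Chains

variable {O V H : Type*} [CommRing O] [AddCommGroup V] [Module O V] [Group H]
  [DistribMulAction H V] [SMulCommClass H O V]

/-- The condition under which `u` plays the role of a uniformizer for the `O`-submodules of `V`
in the family `𝒮`: they are stable under `u`, and there are none strictly between `u • T` and
`T`. -/
structure IsUniserial (u : H) (𝒮 : Set (Submodule O V)) (T : Submodule O V) : Prop where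
  supClosed : SupClosed 𝒮
  zpow_smul_mem : ∀ S ∈ 𝒮, ∀ i : ℤ, u ^ i • S ∈ 𝒮
  smul_le : ∀ S ∈ 𝒮, u • S ≤ S
  mem : T ∈ 𝒮
  eq_or_eq : ∀ S ∈ 𝒮, u • T ≤ S → S ≤ T → S = u • T ∨ S = T

variable {u : H} {𝒮 : Set (Submodule O V)} {T : Submodule O V} {ϖ : O} {m : ℕ}

theorem isUniserial_setOf_smul_le (huT : u • T ≤ T)
    (h : ∀ S, u • S ≤ S → u • T ≤ S → S ≤ T → S = u • T ∨ S = T) :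
    IsUniserial u {S | u • S ≤ S} T where
  supClosed S hS S' hS' := by
    rw [Set.mem_ofPred_eq, Submodule.smul_sup']
    exact sup_le_sup hS hS'
  zpow_smul_mem S hS i := by
    rw [Set.mem_ofPred_eq, smul_smul, mul_self_zpow, zpow_add_one, mul_smul]
    exact smul_mono_right _ hS
  smul_le _ hS := hS
  mem := huT
  eq_or_eq := h

theorem le_sup_pow_smul {S : Submodule O V} (huS : u • S ≤ S) (h : T ≤ S ⊔ u • T) (k : ℕ) :
    T ≤ S ⊔ u ^ k • T := by
  induction k with
  | zero => simp
  | succ k ih =>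
    refine h.trans (sup_le le_sup_left ?_)
    calc u • T ≤ u • (S ⊔ u ^ k • T) := smul_mono_right u ih
      _ = u • S ⊔ u ^ (k + 1) • T := by rw [Submodule.smul_sup', smul_smul, pow_succ']
      _ ≤ S ⊔ u ^ (k + 1) • T := sup_le_sup_right huS _

theorem le_of_le_sup_smul [IsLocalRing O] (hϖ : Irreducible ϖ) (hT : T.FG) {S : Submodule O V}
    (h : T ≤ S ⊔ ϖ • T) : T ≤ S := by
  refine Submodule.le_of_le_smul_of_le_jacobson_bot (I := IsLocalRing.maximalIdeal O) hT
    (IsLocalRing.maximalIdeal_le_jacobson ⊥) (h.trans (sup_le_sup_left ?_ S))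
  rintro _ ⟨x, hx, rfl⟩
  exact Submodule.smul_mem_smul hϖ.not_isUnit hx

theorem IsUniserial.eq_of_not_le [IsLocalRing O] (h : IsUniserial u 𝒮 T) (hϖ : Irreducible ϖ)
    (hu : u ^ m • T ≤ ϖ • T) (hT : T.FG) {S : Submodule O V} (hS : S ∈ 𝒮) (hle : S ≤ T)
    (hnle : ¬ S ≤ u • T) : S = T := by
  have huT : u • T ∈ 𝒮 := by simpa using h.zpow_smul_mem T h.mem 1
  have hsup : S ⊔ u • T = T := (h.eq_or_eq _ (h.supClosed hS huT) le_sup_right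
    (sup_le hle (h.smul_le T h.mem))).resolve_left fun heq ↦ hnle (heq ▸ le_sup_left)
  refine hle.antisymm (le_of_le_sup_smul hϖ hT ?_)
  exact (le_sup_pow_smul (h.smul_le S hS) hsup.ge m).trans (sup_le_sup_left hu S)

theorem not_le_smul [IsLocalRing O] (hT : T.FG) (hT0 : T ≠ ⊥) (hϖ : Irreducible ϖ)
    (hu : u ^ m • T ≤ ϖ • T) : ¬ T ≤ u • T := by
  intro h
  have hm : T ≤ ⊥ ⊔ u ^ m • T := le_sup_pow_smul (by simp) (by simpa using h) m
  exact hT0 (le_bot_iff.1 (le_of_le_sup_smul hϖ hT (hm.trans (sup_le_sup_left hu ⊥))))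

theorem strictAnti_zpow_smul [IsLocalRing O] (hT : T.FG) (hT0 : T ≠ ⊥) (hϖ : Irreducible ϖ)
    (huT : u • T ≤ T) (hu : u ^ m • T ≤ ϖ • T) : StrictAnti fun i : ℤ ↦ u ^ i • T := by
  refine strictAnti_int_of_succ_lt fun i ↦ ?_
  rw [zpow_add_one, mul_smul]
  refine lt_of_le_not_ge (smul_mono_right _ huT) fun h ↦ not_le_smul hT hT0 hϖ hu ?_
  simpa [smul_smul] using smul_mono_right (u ^ i)⁻¹ h

theorem smul_smul_submodule_comm (h : H) (a : O) (S : Submodule O V) : h • a • S = a • h • S :=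
  SetLike.coe_injective <| by
    simpa only [Submodule.coe_pointwise_smul] using smul_comm h a (S : Set V)

theorem smul_submodule_eq_smul {a : O} (h : ∀ x : V, u • x = a • x) (S : Submodule O V) :
    u • S = a • S :=
  SetLike.coe_injective <| Set.image_congr fun x _ ↦ h x

variable [IsDomain O] [IsDiscreteValuationRing O]

theorem exists_pow_smul_le_smul (hϖ : Irreducible ϖ) (hu : u ^ m • T ≤ ϖ • T) {a : O} (ha : a ≠ 0) :
    ∃ k : ℕ, u ^ k • T ≤ a • T := by
  obtain ⟨n, ε, rfl⟩ := IsDiscreteValuationRing.eq_unit_mul_pow_irreducible ha hϖ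
  have hpow : ∀ n : ℕ, u ^ (m * n) • T ≤ ϖ ^ n • T := fun n ↦ by
    induction n with
    | zero => simp
    | succ n ih =>
      calc u ^ (m * (n + 1)) • T = u ^ (m * n) • u ^ m • T := by
            rw [smul_smul, ← pow_add, mul_add_one]
        _ ≤ u ^ (m * n) • ϖ • T := smul_mono_right _ hu
        _ = ϖ • u ^ (m * n) • T := smul_smul_submodule_comm _ _ _
        _ ≤ ϖ • ϖ ^ n • T := smul_mono_right _ ih
        _ = ϖ ^ (n + 1) • T := by rw [smul_smul, ← pow_succ']
  refine ⟨m * n, (hpow n).trans ?_⟩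
  rintro _ ⟨x, hx, rfl⟩
  refine ⟨(↑ε⁻¹ : O) • x, T.smul_mem _ hx, ?_⟩
  simp [smul_smul]

theorem IsUniserial.exists_eq_zpow_smul {K : Type*} [Field K] [Algebra O K] [IsFractionRing O K]
    [Module K V] [IsScalarTower O K V] [hT : T.IsLattice K] (hT0 : T ≠ ⊥)
    (h : IsUniserial u 𝒮 T) (hϖ : Irreducible ϖ) (hu : u ^ m • T ≤ ϖ • T)
    {S : Submodule O V} [hS : S.IsLattice K] (hmem : S ∈ 𝒮) : ∃ i : ℤ, S = u ^ i • T := by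
  have hanti := strictAnti_zpow_smul hT.fg hT0 hϖ (h.smul_le T h.mem) hu
  have hne : ∃ i : ℤ, S ≤ u ^ i • T := by
    obtain ⟨a, ha⟩ := exists_smul_le K hS.fg T
    obtain ⟨k, hk⟩ := exists_pow_smul_le_smul hϖ hu (nonZeroDivisors.ne_zero a.2)
    have hS : u ^ k • S ≤ T := by
      refine le_of_smul_le_smul_of_ne_zero K (nonZeroDivisors.ne_zero a.2) ?_
      rw [← smul_smul_submodule_comm]
      exact (smul_mono_right _ ha).trans hk
    exact ⟨-k, by simpa [smul_smul] using smul_mono_right (u ^ k)⁻¹ hS⟩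
  have hbdd : ∃ b : ℤ, ∀ i : ℤ, S ≤ u ^ i • T → i ≤ b := by
    obtain ⟨a, ha⟩ := exists_smul_le K hT.fg S
    obtain ⟨k, hk⟩ := exists_pow_smul_le_smul hϖ hu (nonZeroDivisors.ne_zero a.2)
    exact ⟨k, fun i hi ↦ hanti.le_iff_ge.1 <| by simpa using (hk.trans ha).trans hi⟩
  obtain ⟨i, hi, himax⟩ := Int.exists_greatest_of_bdd hbdd hne
  refine ⟨i, ?_⟩
  have key : u ^ (-i) • S = T := by
    refine h.eq_of_not_le hϖ hu hT.fg (h.zpow_smul_mem S hmem _) ?_ fun hle ↦ ?_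
    · simpa [smul_smul] using smul_mono_right (u ^ (-i)) hi
    · have := himax (i + 1) <| by
        simpa [smul_smul, zpow_add_one] using smul_mono_right (u ^ i) hle
      lia
  rw [← key, smul_smul, ← zpow_add, add_neg_cancel, zpow_zero, one_smul]

end Chains

section Completeness

variable {R : Type*} [CommRing R] [IsNoetherianRing R] (I : Ideal R) [IsAdicComplete I R]

theorem isAdicComplete_of_finite (M : Type*) [AddCommGroup M] [Module R M] [Module.Finite R M] :
    IsAdicComplete I M := by
  have hcompletion : Function.Surjective (AdicCompletion.of I R) :=
    AdicCompletion.of_surjective_iff.2 inferInstance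
  have hM : Function.Surjective (AdicCompletion.of I M) := by
    refine LinearMap.range_eq_top.1 (top_unique fun x _ ↦ ?_)
    obtain ⟨t, rfl⟩ := AdicCompletion.ofTensorProduct_surjective_of_finite I M x
    induction t with
    | zero => simp
    | add s t hs ht => rw [map_add]; exact add_mem (hs trivial) (ht trivial)
    | tmul r x =>
      obtain ⟨r, rfl⟩ := hcompletion r
      exact ⟨r • x, by
        simp only [map_smul, AdicCompletion.ofTensorProduct_tmul]
        exact (algebraMap_smul (AdicCompletion I R) r (AdicCompletion.of I M x)).symm⟩
  exact { IsHausdorff.of_le_jacobson I M (IsAdicComplete.le_jacobson_bot I),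
    AdicCompletion.of_surjective_iff.1 hM with }

theorem henselianRing_of_finite (C : Type*) [CommRing C] [Algebra R C] [Module.Finite R C] :
    HenselianRing C (I.map (algebraMap R C)) := by
  have := isAdicComplete_of_finite I C
  have := (IsAdicComplete.map_algebraMap_iff (S := C) I C).2 this
  infer_instance

end Completeness

theorem exists_isIdempotentElem_sub_mem {R : Type*} [CommRing R] (I : Ideal R) [HenselianRing R I]
    {p : R} (hp : p * p - p ∈ I) : ∃ q : R, IsIdempotentElem q ∧ q - p ∈ I := by
  let f : Polynomial R := .X ^ 2 - .X
  have hf : f.Monic := Polynomial.monic_X_pow_sub (Polynomial.degree_X_le.trans_lt (by norm_num))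
  have hsimple : IsUnit (Ideal.Quotient.mk I (f.derivative.eval p)) := by
    refine IsUnit.of_mul_eq_one (Ideal.Quotient.mk I (f.derivative.eval p)) ?_
    rw [← map_mul, ← map_one (Ideal.Quotient.mk I), Ideal.Quotient.eq]
    convert I.mul_mem_left 4 hp using 1
    simp [f]
    ring
  obtain ⟨q, hq, hqp⟩ := HenselianRing.is_henselian f hf p (by simpa [f, sq] using hp) hsimple
  exact ⟨q, sub_eq_zero.1 (by simpa [f, sq] using hq), hqp⟩

open scoped IsMulCommutative in
theorem exists_isIdempotentElem_mem_adjoin {R A : Type*} [CommRing R] [IsNoetherianRing R]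
    [Ring A] [Algebra R A] [Module.Finite R A] {π : R} [IsAdicComplete (Ideal.span {π}) R] {p r : A}
    (hpr : Commute p r) (hp : p * p - p = π • r) :
    ∃ q ∈ Algebra.adjoin R {p, r}, IsIdempotentElem q ∧ ∃ s, q - p = π • s := by
  let C := Algebra.adjoin R {p, r}
  have : IsMulCommutative C := Algebra.isMulCommutative_adjoin R <| by
    rintro a (rfl | rfl) b (rfl | rfl)
    exacts [rfl, hpr, hpr.symm, rfl]
  have : Module.Finite R C := Module.IsNoetherian.finite R C.toSubmodule
  let p' : C := ⟨p, Algebra.subset_adjoin (by simp)⟩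
  let r' : C := ⟨r, Algebra.subset_adjoin (by simp)⟩
  have := henselianRing_of_finite (Ideal.span {π}) C
  have hmem : p' * p' - p' ∈ (Ideal.span {π}).map (algebraMap R C) := by
    rw [show p' * p' - p' = π • r' from Subtype.ext hp, Algebra.smul_def]
    exact Ideal.mul_mem_right _ _ (Ideal.mem_map_of_mem _ (Ideal.mem_span_singleton_self π))
  obtain ⟨q, hq, hqp⟩ := exists_isIdempotentElem_sub_mem _ hmem
  rw [Ideal.map_span, Set.image_singleton, Ideal.mem_span_singleton] at hqp
  obtain ⟨s, hs⟩ := hqp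
  refine ⟨q, q.2, congrArg Subtype.val hq, s, ?_⟩
  rw [← Algebra.smul_def] at hs
  exact congrArg Subtype.val hs

section DiscreteValuation

variable {K : Type*} [Field K] {v : Valuation K ℤᵐ⁰}

theorem associated_of_valuation_eq {x y : v.valuationSubring} (h : v (x : K) = v (y : K)) :
    Associated x y :=
  have hv : v.Integers v.valuationSubring := Valuation.integer.integers v
  associated_of_dvd_dvd (hv.dvd_of_le h.ge) (hv.dvd_of_le h.le)

theorem exists_isUniformizer_of_surjective (hv : Function.Surjective v) :
    IsDiscreteValuationRing v.valuationSubring ∧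
      ∃ ϖ : v.valuationSubring, Irreducible ϖ ∧ v (ϖ : K) = WithZero.exp (-1 : ℤ) := by
  obtain ⟨x, hx⟩ := hv (WithZero.exp (-1 : ℤ))
  have hx1 : v x < 1 := by rw [hx]; decide
  let ϖ : v.valuationSubring := ⟨x, hx1.le⟩
  have : v.IsNontrivial := ⟨⟨x, by simp [hx], hx1.ne⟩⟩
  have : Nontrivial (MonoidWithZeroHom.valueGroup (.ofClass v : K →*₀ ℤᵐ⁰)) := by
    infer_instance
  have hϖ : v.IsUniformizer (ϖ : K) := by
    rw [Valuation.IsUniformizer.iff,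
      Valuation.IsRankOneDiscrete.generator_eq_exp_neg_one_of_surjective hv]
    exact hx
  exact ⟨inferInstance, ϖ,
    (IsDiscreteValuationRing.irreducible_iff_uniformizer ϖ).2 hϖ.is_generator, hx⟩

end DiscreteValuation

theorem isAdicComplete_valuationSubring {K Γ₀ : Type*} [Field K]
    [LinearOrderedCommGroupWithZero Γ₀] [MulArchimedean Γ₀] [Valued K Γ₀] [CompleteSpace K]
    {ϖ : (Valued.v : Valuation K Γ₀).valuationSubring} (hϖ0 : ϖ ≠ 0)
    (hϖ1 : Valued.v (ϖ : K) < 1) :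
    IsAdicComplete (Ideal.span {ϖ}) (Valued.v : Valuation K Γ₀).valuationSubring := by
  let O := (Valued.v : Valuation K Γ₀).valuationSubring
  have : CompleteSpace O := (Valued.isClosed_valuationSubring K).completeSpace_coe
  have : IsUniformAddGroup O := O.toSubring.toAddSubgroup.isUniformAddGroup
  have : IsTopologicalRing O := Subring.instIsTopologicalRing O.toSubring
  have hadic : IsAdic (Ideal.span {ϖ}) := by
    refine isAdic_iff.2 ⟨fun n ↦ ?_, fun s hs ↦ ?_⟩
    · have hϖn : (ϖ : K) ^ n ≠ 0 := pow_ne_zero n fun h ↦ hϖ0 (Subtype.ext h)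
      convert ((Homeomorph.mulLeft₀ _ hϖn).isOpenMap _
        (Valued.isOpen_valuationSubring K)).preimage continuous_subtype_val using 1
      ext x
      rw [Ideal.span_singleton_pow, SetLike.mem_coe, Ideal.mem_span_singleton']
      simp [Subtype.ext_iff, mul_comm]
    · obtain ⟨t, ht, hts⟩ := mem_nhds_subtype _ _ _ |>.1 hs
      obtain ⟨γ, hγ⟩ := Valued.mem_nhds_zero.1 ht
      obtain ⟨n, hn⟩ := ((Valued.tendsto_zero_pow_of_v_lt_one hϖ1).eventually_mem
        (Valued.mem_nhds_zero.2 ⟨γ, subset_rfl⟩)).exists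
      refine ⟨n, fun x hx ↦ hts (hγ ?_)⟩
      rw [Ideal.span_singleton_pow, SetLike.mem_coe, Ideal.mem_span_singleton'] at hx
      obtain ⟨y, rfl⟩ := hx
      refine lt_of_le_of_lt ?_ (Set.mem_ofPred.1 hn)
      rw [Valuation.restrict_le_iff]
      simpa using mul_le_mul_left y.2 _
  exact hadic.isAdicComplete_iff.2 ⟨inferInstance, inferInstance⟩

section BilinearForms

variable {O K V : Type*} [CommRing O] [Field K] [Algebra O K] [AddCommGroup V] [Module K V]
  [Module O V] [IsScalarTower O K V] {f : LinearMap.BilinForm K V}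

section Adjoint

variable {H : Type*} [Group H] [DistribMulAction H V]

theorem apply_zpow_smul_left {u v : H} (huv : ∀ x y, f (u • x) y = f x (v • y)) (i : ℤ) (x y : V) :
    f (u ^ i • x) y = f x (v ^ i • y) := by
  induction i using Int.induction_on generalizing x y with
  | zero => simp
  | succ i ih => rw [zpow_add_one, mul_smul, ih, huv, ← mul_smul, mul_self_zpow, zpow_add_one]
  | pred i ih =>
    have hinv (x y : V) : f (u⁻¹ • x) y = f x (v⁻¹ • y) := by
      simpa using (huv (u⁻¹ • x) (v⁻¹ • y)).symm
    rw [zpow_sub_one, mul_smul, ih, hinv, ← mul_smul, zpow_sub_one,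
      (Commute.refl v).inv_left.zpow_right _ |>.eq]

theorem dualSubmodule_smul [SMulCommClass H O V] {u v : H}
    (huv : ∀ x y, f (u • x) y = f x (v • y)) (T : Submodule O V) :
    f.dualSubmodule (v • T) = u⁻¹ • f.dualSubmodule T := by
  ext x
  constructor
  · refine fun hx ↦ ⟨u • x, fun y hy ↦ ?_, inv_smul_smul u x⟩
    rw [huv]
    exact hx _ (Submodule.smul_mem_pointwise_smul y v T hy)
  · rintro ⟨x, hx, rfl⟩ _ ⟨y, hy, rfl⟩
    have h : f (u • u⁻¹ • x) y ∈ (1 : Submodule O K) := by simpa using hx y hy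
    exact huv (u⁻¹ • x) y ▸ h

end Adjoint

theorem dualSubmodule_units_smul (c : Kˣ) (f : LinearMap.BilinForm K V) (T : Submodule O V) :
    (c • f).dualSubmodule T = c⁻¹ • f.dualSubmodule T := by
  ext x
  constructor
  · exact fun hx ↦ ⟨c • x, fun y hy ↦ by simpa using hx y hy, inv_smul_smul c x⟩
  · rintro ⟨x, hx, rfl⟩ y hy
    simpa [Units.smul_def] using hx y hy

variable [IsFractionRing O K]

variable (K) in
theorem span_range_extendOfIsLattice {ι : Type*} {T : Submodule O V} [T.IsLattice K]
    (b : Module.Basis ι O T) : Submodule.span O (Set.range (b.extendOfIsLattice K)) = T := by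
  have hrange : Set.range (b.extendOfIsLattice K) = T.subtype '' Set.range b := by
    rw [← Set.range_comp]
    exact congrArg Set.range (funext (b.extendOfIsLattice_apply K))
  rw [hrange, ← Submodule.map_span, b.span_eq, Submodule.map_top, Submodule.range_subtype]

variable [IsDomain O] [IsPrincipalIdealRing O]

theorem isLattice_dualSubmodule (hf : f.Nondegenerate) (T : Submodule O V) [T.IsLattice K] :
    (f.dualSubmodule T).IsLattice K := by
  classical
  have := Submodule.IsLattice.free K T
  let b := (Module.Free.chooseBasis O T).extendOfIsLattice K
  have hdual : f.dualSubmodule T = Submodule.span O (Set.range (f.dualBasis hf b)) := by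
    rw [← f.dualSubmodule_span_of_basis hf b, span_range_extendOfIsLattice K]
  rw [hdual]
  refine ⟨Submodule.fg_span (Set.finite_range _), ?_⟩
  rw [Submodule.span_span_of_tower, Module.Basis.span_eq]

theorem dualSubmoduleToDual_bijective (hf : f.Nondegenerate)
    (T : Submodule O V) [hT : T.IsLattice K] : Function.Bijective (f.dualSubmoduleToDual T) := by
  classical
  have := Submodule.IsLattice.free K T
  let b := Module.Free.chooseBasis O T
  let bK := b.extendOfIsLattice K
  refine ⟨f.dualSubmoduleToDual_injective hf T hT.span_eq_top, fun φ ↦ ?_⟩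
  have := bK.finiteDimensional_of_finite
  obtain ⟨v, hv⟩ := (f.toDual hf).surjective (bK.constr K fun i ↦ algebraMap O K (φ (b i)))
  have hvφ (y : T) : f v y = algebraMap O K (φ y) := by
    have hext : (f v).restrictScalars O ∘ₗ T.subtype = Algebra.linearMap O K ∘ₗ φ :=
      b.ext fun i ↦ by
        have hi : f v (bK i) = algebraMap O K (φ (b i)) := by
          rw [← f.toDual_def hf, hv, bK.constr_basis]
        simpa [bK, b.extendOfIsLattice_apply K] using hi
    exact LinearMap.congr_fun hext y
  refine ⟨⟨v, fun y hy ↦ Submodule.mem_one.2 ⟨_, (hvφ ⟨y, hy⟩).symm⟩⟩, LinearMap.ext fun y ↦ ?_⟩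
  refine IsFractionRing.injective O K ?_
  rw [← hvφ]
  exact f.dualSubmoduleParing_spec _ y

variable (O) in
/-- The representation `ρ` has a unimodular symplectic `O`-lattice: a stable `O`-lattice `T` of `V`
carrying a perfect alternating invariant form `T × T → O`. -/
def HasUnimodularLattice {G : Type*} [Group G] (ρ : Representation K G V) : Prop :=
  ∃ (T : Submodule O V) (_ : T.IsLattice K) (hT : ∀ g, ∀ x ∈ T, ρ g x ∈ T)
    (f' : LinearMap.BilinForm O T), f'.IsPerfPair ∧ f'.IsAlt ∧
      ∀ (g : G) (x y : T), f' ⟨ρ g x, hT g x x.2⟩ ⟨ρ g y, hT g y y.2⟩ = f' x y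

theorem hasUnimodularLattice_of_dualSubmodule_eq {G : Type*} [Group G] {ρ : Representation K G V}
    (hf : f.Nondegenerate) (halt : f.IsAlt) (hinv : ∀ g x y, f (ρ g x) (ρ g y) = f x y)
    {T : Submodule O V} [hT : T.IsLattice K] (hstable : ∀ g, ∀ x ∈ T, ρ g x ∈ T)
    (hdual : f.dualSubmodule T = T) : HasUnimodularLattice O ρ := by
  have := Submodule.IsLattice.free K T
  have hOK : Function.Injective (algebraMap O K) := IsFractionRing.injective O K
  let f' : LinearMap.BilinForm O T :=
    f.dualSubmoduleToDual T ∘ₗ (LinearEquiv.ofEq _ _ hdual.symm).toLinearMap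
  have hf' (x y : T) : algebraMap O K (f' x y) = f x y :=
    f.dualSubmoduleParing_spec (LinearEquiv.ofEq _ _ hdual.symm x) y
  refine ⟨T, hT, hstable, f', .of_bijective f' ?_, fun x ↦ hOK ?_, fun g x y ↦ hOK ?_⟩
  · exact (dualSubmoduleToDual_bijective hf T).comp (LinearEquiv.bijective _)
  · rw [hf', map_zero]
    exact halt x
  · rw [hf', hf']
    exact hinv g x y

end BilinearForms

section StableLattices

variable {K V M : Type*} [Field K] [AddCommGroup V] [Module K V] [FiniteDimensional K V] [Monoid M]
  [Finite M]

theorem exists_isLattice_stable (O : Type*) [CommRing O] [Algebra O K] [Module O V]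
    [IsScalarTower O K V] (ρ : Representation K M V) :
    ∃ T : Submodule O V, T.IsLattice K ∧ ∀ g, ∀ x ∈ T, ρ g x ∈ T := by
  let b := Module.finBasis K V
  let orbits : Set V := Set.range fun p : M × Fin (Module.finrank K V) ↦ ρ p.1 (b p.2)
  refine ⟨Submodule.span O orbits, ⟨Submodule.fg_span (Set.finite_range _), ?_⟩, fun g x hx ↦ ?_⟩
  · rw [Submodule.span_span_of_tower, eq_top_iff, ← b.span_eq]
    refine Submodule.span_mono ?_
    rintro _ ⟨i, rfl⟩
    exact ⟨(1, i), by simp⟩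
  · have hle : Submodule.span O orbits ≤
        (Submodule.span O orbits).comap ((ρ g).restrictScalars O) := by
      rw [Submodule.span_le]
      rintro _ ⟨⟨h, i⟩, rfl⟩
      exact Submodule.subset_span ⟨(g * h, i), by simp⟩
    exact hle hx

end StableLattices

section Irreducible

variable {K G V : Type*} [Field K] [Monoid G] [AddCommGroup V] [Module K V]
  {ρ : Representation K G V}

theorem nontrivial_of_isIrreducible (h : ρ.IsIrreducible) : Nontrivial V := by
  by_contra hV
  rw [not_nontrivial_iff_subsingleton] at hV
  obtain ⟨a, b, hab⟩ := h.exists_pair_ne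
  exact hab (Subrepresentation.toSubmodule_injective (Subsingleton.elim _ _))

theorem eq_bot_or_eq_top_of_stable (h : ρ.IsIrreducible) {W : Submodule K V}
    (hW : ∀ g, ∀ x ∈ W, ρ g x ∈ W) : W = ⊥ ∨ W = ⊤ :=
  (h.eq_bot_or_eq_top ⟨W, fun g _ ↦ hW g _⟩).imp
    (congrArg Subrepresentation.toSubmodule) (congrArg Subrepresentation.toSubmodule)

theorem isIrreducible_of_forall_stable [Nontrivial V]
    (h : ∀ W : Submodule K V, (∀ g, ∀ x ∈ W, ρ g x ∈ W) → W = ⊥ ∨ W = ⊤) : ρ.IsIrreducible where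
  exists_pair_ne := ⟨⊥, ⊤, fun hb ↦
    bot_ne_top (α := Submodule K V) (congrArg Subrepresentation.toSubmodule hb)⟩
  eq_bot_or_eq_top W :=
    (h W.toSubmodule fun g _ hx ↦ W.apply_mem_toSubmodule g hx).imp
      (fun h ↦ Subrepresentation.toSubmodule_injective h)
      (fun h ↦ Subrepresentation.toSubmodule_injective h)

end Irreducible

section Average

variable {O N E : Type*} [CommRing O] [Group N] [Fintype N] [Invertible (Fintype.card N : O)]
  [AddCommGroup E] [Module O E]

theorem averageMap_mem {ρ : Representation O N E} {W : Submodule O E}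
    (hW : ∀ g, ∀ w ∈ W, ρ g w ∈ W) {w : E} (hw : w ∈ W) : ρ.averageMap w ∈ W := by
  have haverage : ρ.averageMap w = ⅟(Fintype.card N : O) • ∑ g, ρ g w := by
    simp [Representation.averageMap, GroupAlgebra.average]
  rw [haverage]
  exact W.smul_mem _ (sum_mem fun g _ ↦ hW g w hw)

theorem commute_averageMap_linHom (τ : Representation O N E) (p : Module.End O E) (g : N) :
    Commute (τ g) ((τ.linHom τ).averageMap p) := by
  refine LinearMap.ext fun x ↦ ?_
  have hinv := LinearMap.congr_fun ((τ.linHom τ).averageMap_invariant p g) (τ g x)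
  simpa only [Representation.linHom_apply, LinearMap.comp_apply, Module.End.mul_apply,
    τ.inv_self_apply] using hinv

theorem exists_commute_of_exists_projection_mod (τ : Representation O N E) {S J : Submodule O E}
    (hS : ∀ g, ∀ x ∈ S, τ g x ∈ S) (hJ : ∀ g, ∀ x ∈ J, τ g x ∈ J)
    (hp : ∃ p : Module.End O E, (∀ x, p x ∈ S) ∧ ∀ x ∈ S, p x - x ∈ J) :
    ∃ p : Module.End O E, (∀ g, Commute (τ g) p) ∧ (∀ x, p x ∈ S) ∧ ∀ x ∈ S, p x - x ∈ J := by
  obtain ⟨p, hpS, hpJ⟩ := hp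
  let P := (τ.linHom τ).averageMap p
  let W₁ : Submodule O (Module.End O E) := ⨅ x, S.comap (LinearMap.applyₗ x)
  let W₂ : Submodule O (Module.End O E) := ⨅ x ∈ S, J.comap (LinearMap.applyₗ x)
  have hP₁ : P ∈ W₁ := by
    refine averageMap_mem (fun g q hq ↦ ?_) (by simpa [W₁] using hpS)
    simp only [W₁, Submodule.mem_iInf, Submodule.mem_comap, LinearMap.applyₗ_apply_apply] at hq ⊢
    exact fun x ↦ hS g _ (hq _)
  have hP₂ : P - 1 ∈ W₂ := by
    have hone : (τ.linHom τ).averageMap 1 = 1 := by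
      refine (τ.linHom τ).averageMap_id 1 fun g ↦ ?_
      rw [Representation.linHom_apply, ← Module.End.mul_eq_comp, ← Module.End.mul_eq_comp, one_mul,
        ← map_mul, mul_inv_cancel, map_one]
    rw [← hone, ← map_sub]
    refine averageMap_mem (fun g q hq ↦ ?_) (by simpa [W₂] using hpJ)
    simp only [W₂, Submodule.mem_iInf, Submodule.mem_comap, LinearMap.applyₗ_apply_apply] at hq ⊢
    exact fun x hx ↦ hJ g _ (hq _ (hS g⁻¹ x hx))
  refine ⟨P, commute_averageMap_linHom τ p, ?_, ?_⟩
  · simpa [W₁] using hP₁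
  · simpa [W₂] using hP₂

end Average

section Reduction

variable {O N E : Type*} [CommRing O] [AddCommGroup E] [Module O E] {ϖ : O}

theorem exists_eq_smul_of_forall_mem_smul_top [Module.Projective O E] {q : Module.End O E}
    (hq : ∀ x, q x ∈ ϖ • (⊤ : Submodule O E)) : ∃ r, q = ϖ • r := by
  let mulϖ : Module.End O E := LinearMap.lsmul O E ϖ
  have hmem (x : E) : q x ∈ LinearMap.range mulϖ := by
    obtain ⟨y, -, hy⟩ := hq x
    exact ⟨y, hy⟩
  obtain ⟨r, hr⟩ := Module.projective_lifting_property mulϖ.rangeRestrict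
    (q.codRestrict _ hmem) mulϖ.surjective_rangeRestrict
  refine ⟨r, LinearMap.ext fun x ↦ ?_⟩
  exact congrArg Subtype.val (LinearMap.congr_fun hr x).symm

theorem isSemisimpleModule_quotient_smul_top [IsPrincipalIdealRing O] (hϖ : Irreducible ϖ) :
    IsSemisimpleModule O (E ⧸ ϖ • (⊤ : Submodule O E)) := by
  have := PrincipalIdealRing.isMaximal_of_irreducible hϖ
  let _ := Ideal.Quotient.field (Ideal.span {ϖ})
  have htorsion : Module.IsTorsionBy O (E ⧸ ϖ • (⊤ : Submodule O E)) ϖ := by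
    rintro ⟨x⟩
    exact (Submodule.Quotient.mk_eq_zero _).2 ⟨x, trivial, rfl⟩
  exact ((Module.isTorsionBySet_span_singleton_iff ϖ).2 htorsion).isSemisimpleModule_iff.1
    inferInstance

theorem exists_projection_mod [IsPrincipalIdealRing O] [Module.Projective O E]
    (hϖ : Irreducible ϖ) {S : Submodule O E} (hS : ϖ • ⊤ ≤ S) :
    ∃ p : Module.End O E, (∀ x, p x ∈ S) ∧ ∀ x ∈ S, p x - x ∈ ϖ • (⊤ : Submodule O E) := by
  have := isSemisimpleModule_quotient_smul_top (E := E) hϖ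
  let mk := (ϖ • (⊤ : Submodule O E)).mkQ
  obtain ⟨C, hC⟩ := exists_isCompl (S.map mk)
  obtain ⟨p, hp⟩ := Module.projective_lifting_property mk (Submodule.projection _ C hC ∘ₗ mk)
    (Submodule.mkQ_surjective _)
  have hp (x : E) : mk (p x) = Submodule.projection _ C hC (mk x) := LinearMap.congr_fun hp x
  refine ⟨p, fun x ↦ ?_, fun x hx ↦ ?_⟩
  · have hmem : mk (p x) ∈ S.map mk := hp x ▸ Submodule.projection_apply_mem hC (mk x)
    rwa [← Submodule.mem_comap, Submodule.comap_map_mkQ, sup_eq_right.2 hS] at hmem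
  · rw [← (Submodule.Quotient.eq _)]
    exact (hp x).trans (Submodule.projection_apply_left hC ⟨mk x, Submodule.mem_map_of_mem hx⟩)

variable [IsDomain O]

theorem commute_of_commute_smul {A : Type*} [Ring A] [Algebra O A] [Module.IsTorsionFree O A]
    (hϖ : ϖ ≠ 0) {a r : A} (h : Commute a (ϖ • r)) : Commute a r :=
  smul_right_injective A hϖ (by simpa [Commute, SemiconjBy] using h)

theorem eq_smul_top_or_eq_top_of_stable [IsDiscreteValuationRing O] [Module.Free O E]
    [Module.Finite O E] [Group N] [Finite N] [IsAdicComplete (Ideal.span {ϖ}) O]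
    (hϖ : Irreducible ϖ) (hcard : IsUnit (Nat.card N : O)) {τ : Representation O N E}
    (hτ : ∀ q : Module.End O E, IsIdempotentElem q → (∀ g, Commute (τ g) q) → q = 0 ∨ q = 1)
    {S : Submodule O E} (hS : ∀ g, ∀ x ∈ S, τ g x ∈ S) (hϖS : ϖ • ⊤ ≤ S) :
    S = ϖ • ⊤ ∨ S = ⊤ := by
  have := Fintype.ofFinite N
  have : Invertible (Fintype.card N : O) := (Nat.card_eq_fintype_card (α := N) ▸ hcard).invertible
  obtain ⟨p, hpτ, hpS, hp⟩ := exists_commute_of_exists_projection_mod (J := ϖ • ⊤) τ hS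
    (by rintro g _ ⟨x, -, rfl⟩; exact ⟨τ g x, trivial, ((τ g).map_smul ϖ x).symm⟩)
    (exists_projection_mod hϖ hϖS)
  obtain ⟨r, hr⟩ := exists_eq_smul_of_forall_mem_smul_top (q := p * p - p) fun x ↦ hp _ (hpS x)
  have hcomm {a : Module.End O E} (ha : Commute a p) : Commute a r :=
    commute_of_commute_smul hϖ.ne_zero (hr ▸ (ha.mul_right ha).sub_right ha)
  obtain ⟨q, hq, hqi, s, hs⟩ := exists_isIdempotentElem_mem_adjoin (hcomm (.refl p)) hr
  have hle : Algebra.adjoin O {p, r} ≤ Subalgebra.centralizer O (Set.range τ) := by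
    refine Algebra.adjoin_le ?_
    rintro _ (rfl | rfl) _ ⟨g, rfl⟩
    exacts [hpτ g, hcomm (hpτ g)]
  have hsx (x : E) : q x - p x ∈ ϖ • (⊤ : Submodule O E) :=
    ⟨s x, trivial, (LinearMap.congr_fun hs x).symm⟩
  rcases hτ q hqi fun g ↦ hle hq _ ⟨g, rfl⟩ with rfl | rfl
  · refine .inl (le_antisymm (fun x hx ↦ ?_) hϖS)
    simpa using neg_mem (add_mem (hsx x) (hp x hx))
  · refine .inr (eq_top_iff.2 fun x _ ↦ ?_)
    simpa using add_mem (hϖS (hsx x)) (hpS x)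

end Reduction

section RestrictLattice

variable {O K V : Type*} [CommRing O] [Field K] [Algebra O K] [AddCommGroup V] [Module K V]
  [Module O V] [IsScalarTower O K V]

/-- The action of a group on a stable lattice. -/
def restrictLattice {N : Type*} [Monoid N] (ρ : Representation K N V) (T : Submodule O V)
    (hT : ∀ g, ∀ x ∈ T, ρ g x ∈ T) : Representation O N T where
  toFun g := ((ρ g).restrictScalars O).restrict (hT g)
  map_one' := by ext x; simp
  map_mul' g h := by ext x; simp; rfl

theorem eq_zero_or_eq_one_of_commute_restrictLattice [IsDomain O] [IsFractionRing O K]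
    {N : Type*} [Monoid N] {ρ : Representation K N V} (hρ : ρ.IsIrreducible)
    {T : Submodule O V} [hTl : T.IsLattice K] (hT : ∀ g, ∀ x ∈ T, ρ g x ∈ T)
    {q : Module.End O T} (hq : IsIdempotentElem q)
    (hcomm : ∀ g, Commute (restrictLattice ρ T hT g) q) : q = 0 ∨ q = 1 := by
  let S : Submodule O V := (LinearMap.range q).map T.subtype
  have hstable (g : N) :
      Submodule.span K (S : Set V) ≤ (Submodule.span K (S : Set V)).comap (ρ g) := by
    rw [Submodule.span_le]
    rintro _ ⟨_, ⟨x, rfl⟩, rfl⟩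
    refine Submodule.subset_span ⟨_, ⟨restrictLattice ρ T hT g x, rfl⟩, ?_⟩
    exact congrArg Subtype.val (LinearMap.congr_fun (hcomm g) x).symm
  rcases eq_bot_or_eq_top_of_stable hρ hstable with hbot | htop
  · refine .inl (LinearMap.ext fun x ↦ Subtype.ext ?_)
    have hx : (q x : V) ∈ Submodule.span K (S : Set V) := Submodule.subset_span ⟨q x, ⟨x, rfl⟩, rfl⟩
    simpa [hbot] using hx
  · have := Submodule.IsLattice.finite K T
    have : S.IsLattice K := ⟨(Module.Finite.iff_fg.1 (Module.Finite.range q)).map T.subtype, htop⟩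
    have := Module.IsTorsionFree.trans_faithfulSMul O K V
    obtain ⟨a, ha⟩ := exists_smul_le K hTl.fg S
    refine .inr (LinearMap.ext fun x ↦ ?_)
    obtain ⟨_, ⟨y, rfl⟩, hy⟩ := ha (Submodule.smul_mem_pointwise_smul _ (a : O) T x.2)
    have hy : q y = (a : O) • x := Subtype.ext hy
    refine smul_right_injective T (nonZeroDivisors.ne_zero a.2) ?_
    simpa [hy] using LinearMap.congr_fun hq y

end RestrictLattice

section IrreducibleRestriction

variable {O K V : Type*} [CommRing O] [Field K] [Algebra O K] [AddCommGroup V] [Module K V]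
  [Module O V] [IsScalarTower O K V]

theorem apply_mem_dualSubmodule {G : Type*} [Group G] {ρ : Representation K G V}
    {f : LinearMap.BilinForm K V} (hinv : ∀ g x y, f (ρ g x) (ρ g y) = f x y)
    {T : Submodule O V} (hT : ∀ g, ∀ x ∈ T, ρ g x ∈ T) (g : G) {x : V}
    (hx : x ∈ f.dualSubmodule T) : ρ g x ∈ f.dualSubmodule T := by
  intro y hy
  rw [← ρ.self_inv_apply g y, hinv]
  exact hx _ (hT g⁻¹ y hy)

theorem nondegenerate_units_smul {f : LinearMap.BilinForm K V} (hf : f.Nondegenerate) (c : Kˣ) :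
    (c • f).Nondegenerate :=
  ⟨fun x hx ↦ hf.1 x fun y ↦ (smul_eq_zero_iff_eq c).1 (hx y),
    fun y hy ↦ hf.2 y fun x ↦ (smul_eq_zero_iff_eq c).1 (hy x)⟩

theorem eq_smul_or_eq_of_isIrreducible [IsDomain O] [IsDiscreteValuationRing O]
    [IsFractionRing O K] {N : Type*} [Group N] [Finite N] {ρ : Representation K N V}
    (hρ : ρ.IsIrreducible) {ϖ : O} (hϖ : Irreducible ϖ) [IsAdicComplete (Ideal.span {ϖ}) O]
    (hcard : IsUnit (Nat.card N : O)) {S T : Submodule O V} [T.IsLattice K]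
    (hT : ∀ g, ∀ x ∈ T, ρ g x ∈ T) (hS : ∀ g, ∀ x ∈ S, ρ g x ∈ S) (hϖS : ϖ • T ≤ S) (hST : S ≤ T) :
    S = ϖ • T ∨ S = T := by
  have := Submodule.IsLattice.free K T
  have := Submodule.IsLattice.finite K T
  have hmap : (ϖ • (⊤ : Submodule O T)).map T.subtype = ϖ • T := by
    ext x
    simp [Submodule.mem_smul_pointwise_iff_exists]
  have hsub : (S.comap T.subtype).map T.subtype = S := by
    rw [Submodule.map_comap_subtype, inf_eq_right.2 hST]
  refine (eq_smul_top_or_eq_top_of_stable hϖ hcard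
    (fun q ↦ eq_zero_or_eq_one_of_commute_restrictLattice hρ hT) (S := S.comap T.subtype)
    (fun g x hx ↦ hS g x hx) ?_).imp (fun h ↦ ?_) (fun h ↦ ?_)
  · rw [← Submodule.map_le_iff_le_comap, hmap]
    exact hϖS
  · rw [← hsub, h, hmap]
  · rw [← hsub, h, Submodule.map_top, Submodule.range_subtype]

theorem hasUnimodularLattice_of_isIrreducible_restrict [IsDomain O] [IsDiscreteValuationRing O]
    [IsFractionRing O K] {ϖ : O} (hϖ : Irreducible ϖ) [IsAdicComplete (Ideal.span {ϖ}) O]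
    [FiniteDimensional K V] {G : Type*} [Group G] [Finite G] {ρ : Representation K G V}
    {f : LinearMap.BilinForm K V} (hf : f.Nondegenerate) (halt : f.IsAlt)
    (hinv : ∀ g x y, f (ρ g x) (ρ g y) = f x y) {N : Subgroup G} (hcard : IsUnit (Nat.card N : O))
    (hN : Representation.IsIrreducible (ρ.comp N.subtype)) : HasUnimodularLattice O ρ := by
  obtain ⟨T, hTl, hT⟩ := exists_isLattice_stable O ρ
  have := nontrivial_of_isIrreducible hN
  have hT0 : T ≠ ⊥ := by
    rintro rfl
    exact bot_ne_top (α := Submodule K V) (by simpa using hTl.span_eq_top)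
  have := isLattice_dualSubmodule hf T
  let w : Kˣ := Units.mk0 (algebraMap O K ϖ) (by simpa using hϖ.ne_zero)
  have hw (S : Submodule O V) :=
    smul_submodule_eq_smul (u := w) (algebraMap_smul K ϖ) S
  have hchain : IsUniserial w {S : Submodule O V | ∀ g : N, ∀ x ∈ S, ρ g x ∈ S} T :=
    { supClosed := fun S₁ h₁ S₂ h₂ g ↦ by
        change S₁ ⊔ S₂ ≤ (S₁ ⊔ S₂).comap ((ρ g).restrictScalars O)
        exact sup_le (fun x hx ↦ Submodule.mem_sup_left (h₁ g x hx))
          fun x hx ↦ Submodule.mem_sup_right (h₂ g x hx)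
      zpow_smul_mem := by
        rintro S hS i g _ ⟨x, hx, rfl⟩
        exact ⟨ρ g x, hS g x hx, ((ρ g).map_smul _ x).symm⟩
      smul_le := by
        intro S _
        rw [hw]
        rintro _ ⟨x, hx, rfl⟩
        exact S.smul_mem ϖ hx
      mem := fun g ↦ hT g
      eq_or_eq := fun S hS hwS hST ↦ by
        rw [hw] at hwS ⊢
        exact eq_smul_or_eq_of_isIrreducible hN hϖ hcard (fun g ↦ hT g) hS hwS hST }
  obtain ⟨i, hi⟩ := hchain.exists_eq_zpow_smul (K := K) (m := 1) hT0 hϖ (by rw [pow_one, hw])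
    (S := f.dualSubmodule T) fun g x ↦ apply_mem_dualSubmodule hinv hT g
  refine hasUnimodularLattice_of_dualSubmodule_eq (f := w ^ i • f) (nondegenerate_units_smul hf _)
    (fun x ↦ ?_) (fun g x y ↦ ?_) hT ?_
  · simp [halt x]
  · simp [hinv]
  · rw [dualSubmodule_units_smul, hi]
    exact inv_smul_smul (w ^ i) T

end IrreducibleRestriction

section CyclotomicUnits

-- Here and below `ζ ^ (ℓ - 1)` stands for `ζ⁻¹`, in rings where inverses are not at hand.
theorem associated_sub_pow_pow_of_isPrimitiveRoot {R : Type*} [CommRing R] [IsDomain R] {ζ : R}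
    {ℓ : ℕ} (hℓ : ℓ.Prime) (hodd : Odd ℓ) (hζ : IsPrimitiveRoot ζ ℓ) :
    Associated ((ζ - ζ ^ (ℓ - 1)) ^ (ℓ - 1)) (ℓ : R) := by
  obtain ⟨n, rfl⟩ : ∃ n, ℓ = n + 1 := ⟨ℓ - 1, (Nat.sub_add_cancel hℓ.one_le).symm⟩
  have hn : 2 ≤ n := by
    obtain ⟨k, hk⟩ := hodd
    have := hℓ.two_le
    lia
  have hassoc {k : ℕ} (hk0 : k ≠ 0) (hk : k < n + 1) : Associated (1 - ζ) (1 - ζ ^ k) := by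
    simpa using (hζ.associated_sub_one_pow_sub_one_of_coprime
      (Nat.coprime_of_lt_prime hk0 hk hℓ).symm).neg_neg
  have hfactor : ζ - ζ ^ n = ζ * (1 - ζ ^ (n - 1)) := by
    rw [mul_sub, mul_one, mul_pow_sub_one (by lia)]
  have hu : Associated (ζ - ζ ^ n) (1 - ζ) := by
    rw [hfactor]
    exact (associated_unit_mul_left _ _ (hζ.isUnit hℓ.ne_zero)).trans
      (hassoc (by lia) (by lia)).symm
  rw [Nat.add_sub_cancel]
  refine hu.pow_pow.trans ?_
  rw [Nat.cast_succ, ← hζ.prod_one_sub_pow_eq_order]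
  nth_rewrite 1 [← Finset.card_range n]
  rw [← Finset.prod_const]
  refine Associated.prod _ _ _ fun k hk ↦ hassoc k.succ_ne_zero ?_
  exact Nat.succ_lt_succ (Finset.mem_range.1 hk)

theorem sub_pow_ne_zero_of_isPrimitiveRoot {L : Type*} [Field L] {ζ : L} {ℓ : ℕ} (hℓ : 1 < ℓ)
    (hodd : Odd ℓ) (hζ : IsPrimitiveRoot ζ ℓ) : ζ - ζ ^ (ℓ - 1) ≠ 0 := by
  intro h
  have h1 : 1 = ℓ - 1 := hζ.pow_inj hℓ (by lia) ((pow_one ζ).trans (sub_eq_zero.1 h))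
  obtain ⟨k, rfl⟩ := hodd
  lia

end CyclotomicUnits

section Determinants

variable {O E : Type*} [CommRing O] [IsDomain O] [AddCommGroup E] [Module O E]

theorem eq_range_or_eq_top_of_irreducible_det [IsPrincipalIdealRing O] [Module.Free O E]
    [Module.Finite O E] {U : Module.End O E} (hU : Irreducible (LinearMap.det U))
    {S : Submodule O E} (hS : LinearMap.range U ≤ S) : S = LinearMap.range U ∨ S = ⊤ := by
  have hinj : Function.Injective U := by
    rw [← LinearMap.ker_eq_bot]
    by_contra hker
    exact hU.ne_zero (LinearMap.det_eq_zero_iff_ker_ne_bot.2 hker)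
  have hrank : Module.finrank O E = Module.finrank O S :=
    le_antisymm (LinearMap.finrank_range_of_inj hinj ▸ Submodule.finrank_mono hS)
      (Submodule.finrank_le S)
  let φ : E ≃ₗ[O] S := LinearEquiv.ofFinrankEq E S hrank
  let A : Module.End O E := S.subtype ∘ₗ φ.toLinearMap
  let B : Module.End O E := φ.symm.toLinearMap ∘ₗ U.codRestrict S fun x ↦ hS ⟨x, rfl⟩
  have hAB : U = A * B := by
    ext x
    simp [A, B]
  have hA : LinearMap.range A = S := by
    simp [A, LinearMap.range_comp]
  rw [hAB, map_mul] at hU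
  rcases hU.isUnit_or_isUnit rfl with hunit | hunit
  · have hsurj := ((Module.End.isUnit_iff A).1 ((LinearMap.isUnit_iff_isUnit_det A).2 hunit)).2
    exact .inr (hA ▸ LinearMap.range_eq_top.2 hsurj)
  · have hsurj := ((Module.End.isUnit_iff B).1 ((LinearMap.isUnit_iff_isUnit_det B).2 hunit)).2
    left
    rw [hAB, Module.End.mul_eq_comp, LinearMap.range_comp_of_range_eq_top _
      (LinearMap.range_eq_top.2 hsurj), hA]

theorem irreducible_of_associated_pow [IsDiscreteValuationRing O] {ϖ x : O} (hϖ : Irreducible ϖ)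
    {m k : ℕ} (hk : k ≠ 0) (hkm : k < 2 * m) (h : Associated (x ^ m) (ϖ ^ k)) :
    Irreducible x := by
  have hx : x ≠ 0 := by
    rintro rfl
    rw [zero_pow (by lia)] at h
    exact pow_ne_zero k hϖ.ne_zero (associated_zero_iff_eq_zero _ |>.1 h.symm)
  obtain ⟨a, ha⟩ := IsDiscreteValuationRing.associated_pow_irreducible hx hϖ
  have ham : a * m = k := by
    have hpow : Associated (ϖ ^ (a * m)) (ϖ ^ k) := by
      rw [pow_mul]
      exact ha.symm.pow_pow.trans h
    exact le_antisymm ((pow_dvd_pow_iff hϖ.ne_zero hϖ.not_isUnit).1 hpow.dvd)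
      ((pow_dvd_pow_iff hϖ.ne_zero hϖ.not_isUnit).1 hpow.symm.dvd)
  have ha1 : a = 1 := by
    have ha0 : a ≠ 0 := by
      rintro rfl
      exact hk (by rw [← ham, zero_mul])
    have ha2 : a < 2 := lt_of_mul_lt_mul_right (ham ▸ hkm) (Nat.zero_le m)
    lia
  rw [ha1, pow_one] at ha
  exact ha.symm.irreducible hϖ

theorem irreducible_det_of_associated_pow_natCast [IsDiscreteValuationRing O] [Module.Free O E]
    [Module.Finite O E] [Nontrivial E] {R : Type*} [CommRing R] [Algebra O R]
    (φ : R →ₐ[O] Module.End O E) {ϖ : O} (hϖ : Irreducible ϖ) {ℓ e d m : ℕ} (he0 : e ≠ 0)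
    (hE : Module.finrank O E = 2 * d) (he : Associated (ℓ : O) (ϖ ^ e)) (hm : d * e < m)
    {u : R} (hu : Associated (u ^ m) (ℓ : R)) : Irreducible (LinearMap.det (φ u)) := by
  have hd0 : d ≠ 0 := by
    have := Module.finrank_pos (R := O) (M := E)
    lia
  have hdetℓ : LinearMap.det (φ ℓ) = (ℓ : O) ^ (2 * d) := by
    rw [← hE, map_natCast, ← map_natCast (algebraMap O (Module.End O E)),
      Module.algebraMap_end_eq_smul_id, LinearMap.det_smul, LinearMap.det_id, mul_one]
  refine irreducible_of_associated_pow hϖ (m := m) (k := e * (2 * d)) (by positivity)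
    (by linarith) ?_
  calc LinearMap.det (φ u) ^ m = LinearMap.det (φ (u ^ m)) := by simp only [map_pow]
    Associated _ (LinearMap.det (φ ℓ)) := (hu.map φ).map LinearMap.det
    _ = (ℓ : O) ^ (2 * d) := hdetℓ
    Associated _ (ϖ ^ (e * (2 * d))) := by
      rw [pow_mul ϖ]
      exact he.pow_pow

end Determinants

section MultiplierRing

variable {O L V : Type*} [CommRing O] [Field L] [Algebra O L] [AddCommGroup V] [Module L V]
  [Module O V] [IsScalarTower O L V]

variable (L) in
/-- The multiplier ring of a lattice `T`: the scalars `r` such that `r T ⊆ T`. -/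
def multiplierRing (T : Submodule O V) : Subalgebra O L where
  carrier := {r | ∀ x ∈ T, r • x ∈ T}
  mul_mem' {r s} hr hs x hx := by
    rw [mul_smul]
    exact hr _ (hs x hx)
  add_mem' {r s} hr hs x hx := by
    rw [add_smul]
    exact add_mem (hr x hx) (hs x hx)
  algebraMap_mem' a x hx := by
    rw [algebraMap_smul]
    exact T.smul_mem a hx

namespace multiplierRing

/-- The action of the multiplier ring on the lattice. -/
def toEnd (T : Submodule O V) : multiplierRing L T →ₐ[O] Module.End O T :=
  AlgHom.ofLinearMap
    { toFun := fun r ↦ (Algebra.lsmul O O V (r : L)).restrict r.2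
      map_add' := fun _ _ ↦ LinearMap.ext fun _ ↦ Subtype.ext (add_smul ..)
      map_smul' := fun _ _ ↦ LinearMap.ext fun _ ↦ Subtype.ext (smul_assoc ..) }
    (LinearMap.ext fun _ ↦ Subtype.ext (one_smul ..))
    fun _ _ ↦ LinearMap.ext fun _ ↦ Subtype.ext (mul_smul ..)

end multiplierRing

theorem units_smul_submodule_eq {T : Submodule O V} {w : Lˣ} (hw : (w : L) ∈ multiplierRing L T)
    (hw' : ((w⁻¹ : Lˣ) : L) ∈ multiplierRing L T) : w • T = T := by
  refine le_antisymm ?_ fun x hx ↦ ⟨w⁻¹ • x, hw' x hx, smul_inv_smul w x⟩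
  rintro _ ⟨x, hx, rfl⟩
  exact hw x hx

theorem smul_submodule_eq_of_associated {T : Submodule O V} {u : Lˣ} {a : O}
    {r : multiplierRing L T} (hu : (u : L) = r) (h : Associated r (algebraMap O _ a)) :
    u • T = a • T := by
  obtain ⟨w, hw⟩ := h
  have hwT : Units.map (multiplierRing L T).val.toMonoidHom w • T = T :=
    units_smul_submodule_eq (w : multiplierRing L T).2 (↑w⁻¹ : multiplierRing L T).2
  calc u • T = (u * Units.map (multiplierRing L T).val.toMonoidHom w) • T := by
        rw [mul_smul, hwT]
    _ = a • T := smul_submodule_eq_smul (fun x ↦ ?_) T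
  rw [Units.smul_def, ← algebraMap_smul L a x]
  congr 1
  simpa [hu] using congrArg ((↑) : multiplierRing L T → L) hw

end MultiplierRing

section ScalarUniformizers

variable {O K L V : Type*} [CommRing O] [IsDomain O] [IsDiscreteValuationRing O] [Field K]
  [Algebra O K] [Field L] [Algebra O L] [AddCommGroup V]
  [Module O V] [Module K V] [Module L V] [IsScalarTower O K V] [IsScalarTower O L V]
  {T : Submodule O V} {u : Lˣ}

theorem isUniserial_of_irreducible_det [Module.Free O T] [Module.Finite O T]
    {r : multiplierRing L T} (hr : (u : L) = r)
    (hdet : Irreducible (LinearMap.det (multiplierRing.toEnd T r))) :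
    IsUniserial u {S | u • S ≤ S} T := by
  have hrange : (LinearMap.range (multiplierRing.toEnd T r)).map T.subtype = u • T := by
    ext x
    constructor
    · rintro ⟨_, ⟨y, rfl⟩, rfl⟩
      exact ⟨y, y.2, congrArg (· • (y : V)) hr⟩
    · rintro ⟨y, hy, rfl⟩
      exact ⟨_, ⟨⟨y, hy⟩, rfl⟩, congrArg (· • y) hr.symm⟩
  refine isUniserial_setOf_smul_le (hrange ▸ Submodule.map_subtype_le T _) fun S _ hle hST ↦ ?_
  have hS : (S.comap T.subtype).map T.subtype = S := by
    rw [Submodule.map_comap_subtype, inf_eq_right.2 hST]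
  have hle' : LinearMap.range (multiplierRing.toEnd T r) ≤ S.comap T.subtype := by
    rw [← Submodule.map_le_iff_le_comap, hrange]
    exact hle
  rw [← hS]
  refine (eq_range_or_eq_top_of_irreducible_det hdet hle').imp (fun h ↦ ?_) fun h ↦ ?_
  · rw [h]
    exact hrange
  · rw [h, Submodule.map_subtype_top]

theorem IsUniserial.finrank_eq_one [Nontrivial V] {ϖ : O} {m : ℕ} [hT : T.IsLattice K]
    [Algebra K L] [IsScalarTower K L V] (h : IsUniserial u {S | u • S ≤ S} T)
    (hϖ : Irreducible ϖ) (hu : u ^ m • T ≤ ϖ • T) :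
    Module.finrank L V = 1 := by
  have hT0 : T ≠ ⊥ := by
    rintro rfl
    simpa using hT.span_eq_top
  obtain ⟨t, ht, htu⟩ := SetLike.not_le_iff_exists.1 (not_le_smul hT.fg hT0 hϖ hu)
  let S : Submodule O V := T ⊓ (Submodule.span L {t}).restrictScalars O
  have ht_mem : t ∈ S := ⟨ht, Submodule.mem_span_singleton_self t⟩
  have hS : S ∈ {S : Submodule O V | u • S ≤ S} := by
    rintro _ ⟨x, hx, rfl⟩
    exact ⟨h.smul_le T h.mem (Submodule.smul_mem_pointwise_smul x u T hx.1),
      Submodule.smul_mem _ (u : L) hx.2⟩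
  have hST : S = T := h.eq_of_not_le hϖ hu hT.fg hS inf_le_left fun hle ↦ htu (hle ht_mem)
  have hspan : (⊤ : Submodule K V) ≤ (Submodule.span L {t}).restrictScalars K := by
    rw [← hT.span_eq_top, Submodule.span_le]
    exact fun x hx ↦ (hST.ge hx).2
  refine _root_.finrank_eq_one t (fun ht0 ↦ htu (ht0 ▸ zero_mem _)) fun x ↦ ?_
  exact Submodule.mem_span_singleton.1 (hspan trivial)

theorem exists_eq_smul_of_commute_smul (hV : Module.finrank L V = 1) {A : V → V}
    (hadd : ∀ x y, A (x + y) = A x + A y) (hsmul : ∀ (a : L) x, A (a • x) = a • A x) :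
    ∃ a : L, ∀ x, A x = a • x := by
  let A' : V →ₗ[L] V := ⟨⟨A, hadd⟩, hsmul⟩
  obtain ⟨a, ha, -⟩ := A'.existsUnique_eq_smul_id_of_finrank_eq_one hV
  exact ⟨a, LinearMap.congr_fun ha⟩

end ScalarUniformizers

section CyclotomicLattices

variable {O K L V : Type*} [CommRing O] [IsDomain O] [IsDiscreteValuationRing O] [Field K]
  [Algebra O K] [IsFractionRing O K] [Field L] [Algebra O L] [AddCommGroup V]
  [Module O V] [Module K V] [Module L V] [IsScalarTower O K V] [IsScalarTower O L V]

theorem isUniserial_of_isPrimitiveRoot [FiniteDimensional K V] [Nontrivial V] {T : Submodule O V}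
    [hT : T.IsLattice K] {ϖ : O} (hϖ : Irreducible ϖ) {ℓ e d : ℕ} (hℓ : ℓ.Prime) (hodd : Odd ℓ)
    (he0 : e ≠ 0) (hV : Module.finrank K V = 2 * d) (he : Associated (ℓ : O) (ϖ ^ e))
    (hlt : d * e + 1 < ℓ) {ζ : L} (hζ : IsPrimitiveRoot ζ ℓ) (hζT : ζ ∈ multiplierRing L T)
    {u : Lˣ} (hu : (u : L) = ζ - ζ ^ (ℓ - 1)) :
    IsUniserial u {S | u • S ≤ S} T ∧ u ^ (ℓ - 1) • T ≤ ϖ • T := by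
  have := Submodule.IsLattice.free K T
  have := Module.Finite.iff_fg.2 hT.fg
  have hrank : Module.finrank O T = 2 * d :=
    hV ▸ congrArg Cardinal.toNat (Submodule.IsLattice.rank' K T)
  have : Nontrivial T := Module.nontrivial_of_finrank_pos (R := O) <|
    hrank ▸ hV ▸ Module.finrank_pos
  let ζT : multiplierRing L T := ⟨ζ, hζT⟩
  have hassoc : Associated ((ζT - ζT ^ (ℓ - 1)) ^ (ℓ - 1)) (ℓ : multiplierRing L T) :=
    associated_sub_pow_pow_of_isPrimitiveRoot hℓ hodd (IsPrimitiveRoot.coe_submonoidClass_iff.1 hζ)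
  refine ⟨isUniserial_of_irreducible_det hu (irreducible_det_of_associated_pow_natCast _ hϖ he0
    hrank he (by lia) hassoc), ?_⟩
  have huℓ : u ^ (ℓ - 1) • T = (ℓ : O) • T :=
    smul_submodule_eq_of_associated (r := (ζT - ζT ^ (ℓ - 1)) ^ (ℓ - 1)) (by simp [hu, ζT])
      (by rwa [map_natCast])
  rw [huℓ]
  obtain ⟨c, hc⟩ := (dvd_pow_self ϖ he0).trans he.symm.dvd
  rw [hc, mul_smul]
  refine smul_mono_right ϖ ?_
  rintro _ ⟨x, hx, rfl⟩
  exact T.smul_mem c hx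

end CyclotomicLattices

section SkewAdjoint

variable {H V : Type*} [Group H] [AddCommGroup V] [DistribMulAction H V] {u v : H}

theorem zpow_smul_eq_or_eq_neg (hv : ∀ x : V, v • x = -(u • x)) (i : ℤ) (x : V) :
    v ^ i • x = u ^ i • x ∨ v ^ i • x = -(u ^ i • x) := by
  induction i using Int.induction_on generalizing x with
  | zero => simp
  | succ i ih =>
    rw [zpow_add_one, zpow_add_one, mul_smul, mul_smul, hv, smul_neg, neg_inj, neg_eq_iff_eq_neg]
    exact (ih (u • x)).symm
  | pred i ih =>
    have hinv : v⁻¹ • x = -(u⁻¹ • x) := by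
      rw [inv_smul_eq_iff, hv, smul_neg, smul_inv_smul, neg_neg]
    rw [zpow_sub_one, zpow_sub_one, mul_smul, mul_smul, hinv, smul_neg, neg_inj,
      neg_eq_iff_eq_neg]
    exact (ih (u⁻¹ • x)).symm

theorem zpow_smul_submodule_eq {O : Type*} [CommRing O] [Module O V] [SMulCommClass H O V]
    (hv : ∀ x : V, v • x = -(u • x)) (i : ℤ) (S : Submodule O V) : v ^ i • S = u ^ i • S := by
  have hle {v u : H} (hv : ∀ x : V, v • x = -(u • x)) : v ^ i • S ≤ u ^ i • S := by
    rintro _ ⟨x, hx, rfl⟩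
    change v ^ i • x ∈ u ^ i • S
    have hux := Submodule.smul_mem_pointwise_smul x (u ^ i) S hx
    rcases zpow_smul_eq_or_eq_neg hv i x with h | h <;> rw [h]
    exacts [hux, neg_mem hux]
  exact (hle hv).antisymm (hle fun x ↦ by rw [hv, neg_neg])

variable {K : Type*} [Field K] [Module K V] {f : LinearMap.BilinForm K V}

theorem apply_zpow_smul_self (halt : f.IsAlt) (hv : ∀ x : V, v • x = -(u • x))
    (hf : ∀ x y, f (u • x) y = f x (v • y)) (s : ℤ) (x : V) : f (u ^ (2 * s) • x) x = 0 := by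
  rw [two_mul, zpow_add, mul_smul, apply_zpow_smul_left hf]
  rcases zpow_smul_eq_or_eq_neg hv s x with h | h
  · rw [h, halt]
  · rw [h, map_neg, halt, neg_zero]

variable {O : Type*} [CommRing O] [Algebra O K] [Module O V] [IsScalarTower O K V]
  [SMulCommClass H O V]

theorem isLattice_smul [SMulCommClass H K V] (h : H) (T : Submodule O V) [hT : T.IsLattice K] :
    (h • T).IsLattice K := by
  refine ⟨hT.fg.map _, ?_⟩
  rw [Submodule.coe_pointwise_smul, ← Submodule.smul_span, hT.span_eq_top]
  exact eq_top_iff.2 fun x _ ↦ ⟨h⁻¹ • x, trivial, smul_inv_smul h x⟩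

variable [IsDomain O] [IsDiscreteValuationRing O] {T : Submodule O V} {ϖ : O} {m : ℕ}

-- As `T = O t + u T` and `f (u ^ (2 * s) t) t = 0`, the dual of `T` would contain `u ^ (2 * s) t`,
-- hence `u ^ (2 * s) T`.
theorem dualSubmodule_ne_zpow_odd_smul [hT : T.IsLattice K] (hT0 : T ≠ ⊥) (halt : f.IsAlt)
    (hv : ∀ x : V, v • x = -(u • x)) (huv : ∀ x y, f (u • x) y = f x (v • y))
    (h : IsUniserial u {S | u • S ≤ S} T) (hϖ : Irreducible ϖ) (hu : u ^ m • T ≤ ϖ • T) (s : ℤ) :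
    f.dualSubmodule T ≠ u ^ (2 * s + 1) • T := by
  intro hdual
  obtain ⟨t, ht, htu⟩ := SetLike.not_le_iff_exists.1 (not_le_smul hT.fg hT0 hϖ hu)
  have huT : u • T ≤ T := h.smul_le T h.mem
  have hgen : Submodule.span O {t} ⊔ u • T = T := by
    have hle : Submodule.span O {t} ⊔ u • T ≤ T :=
      sup_le ((Submodule.span_singleton_le_iff_mem t T).2 ht) huT
    refine (h.eq_or_eq _ ?_ le_sup_right hle).resolve_left fun heq ↦ htu ?_
    · exact (smul_mono_right u hle).trans le_sup_right
    · exact heq ▸ Submodule.mem_sup_left (Submodule.mem_span_singleton_self t)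
  have huD (x : V) (hx : x ∈ T) : u ^ (2 * s) • u • x ∈ f.dualSubmodule T := by
    rw [hdual, smul_smul, ← zpow_add_one]
    exact Submodule.smul_mem_pointwise_smul x _ T hx
  have htD : u ^ (2 * s) • t ∈ f.dualSubmodule T := by
    intro y hy
    obtain ⟨_, hat, _, ⟨z, hz, rfl⟩, rfl⟩ := Submodule.mem_sup.1 (hgen.ge hy)
    obtain ⟨a, rfl⟩ := Submodule.mem_span_singleton.1 hat
    have huz : f (u ^ (2 * s) • t) (u • z) = -f (u ^ (2 * s) • u • t) z := by
      rw [smul_smul, ← (Commute.self_zpow u _).eq, mul_smul, huv, hv, map_neg, neg_neg]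
    change f (u ^ (2 * s) • t) (a • t + u • z) ∈ _
    rw [map_add, huz, LinearMap.map_smul_of_tower, apply_zpow_smul_self halt hv huv, smul_zero,
      zero_add]
    exact neg_mem (huD t ht z hz)
  have hle : u ^ (2 * s) • T ≤ u ^ (2 * s + 1) • T := by
    rw [← hdual]
    rintro _ ⟨x, hx, rfl⟩
    obtain ⟨_, hat, _, ⟨z, hz, rfl⟩, rfl⟩ := Submodule.mem_sup.1 (hgen.ge hx)
    obtain ⟨a, rfl⟩ := Submodule.mem_span_singleton.1 hat
    change u ^ (2 * s) • (a • t + u • z) ∈ _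
    rw [smul_add, smul_comm]
    exact add_mem (Submodule.smul_mem _ a htD) (huD z hz)
  exact (strictAnti_zpow_smul hT.fg hT0 hϖ huT hu (lt_add_one (2 * s))).not_ge hle

variable [IsFractionRing O K]

theorem hasUnimodularLattice_of_skewAdjoint [Nontrivial V] [SMulCommClass H K V] {G : Type*}
    [Group G] {ρ : Representation K G V} (hf : f.Nondegenerate) (halt : f.IsAlt)
    (hinv : ∀ g x y, f (ρ g x) (ρ g y) = f x y) [hT : T.IsLattice K]
    (hstable : ∀ g, ∀ x ∈ T, ρ g x ∈ T) (hρ : ∀ g (h : H) x, ρ g (h • x) = h • ρ g x)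
    (hv : ∀ x : V, v • x = -(u • x)) (huv : ∀ x y, f (u • x) y = f x (v • y))
    (h : IsUniserial u {S | u • S ≤ S} T) (hϖ : Irreducible ϖ) (hu : u ^ m • T ≤ ϖ • T) :
    HasUnimodularLattice O ρ := by
  have hT0 : T ≠ ⊥ := by
    rintro rfl
    simpa using hT.span_eq_top
  have := isLattice_dualSubmodule hf T
  have hdual_mem : u • f.dualSubmodule T ≤ f.dualSubmodule T := by
    rintro _ ⟨x, hx, rfl⟩ y hy
    have huy : u • y ∈ T := h.smul_le T h.mem (Submodule.smul_mem_pointwise_smul y u T hy)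
    change f (u • x) y ∈ _
    rw [huv, hv, map_neg]
    exact neg_mem (hx _ huy)
  obtain ⟨c, hc⟩ := h.exists_eq_zpow_smul hT0 hϖ hu (S := f.dualSubmodule T) hdual_mem
  obtain ⟨s, hs⟩ := Int.even_or_odd' c
  rcases hs with rfl | rfl
  · have := isLattice_smul (K := K) (u ^ s) T
    refine hasUnimodularLattice_of_dualSubmodule_eq hf halt hinv (T := u ^ s • T) ?_ ?_
    · rintro g _ ⟨x, hx, rfl⟩
      exact ⟨ρ g x, hstable g x hx, (hρ g _ x).symm⟩
    · have hvu (x y : V) : f (v • x) y = f x (u • y) := by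
        rw [hv, map_neg, LinearMap.neg_apply, huv, hv, map_neg, neg_neg]
      rw [dualSubmodule_smul (apply_zpow_smul_left hvu s), ← zpow_neg,
        zpow_smul_submodule_eq hv, hc, smul_smul, ← zpow_add]
      congr 2
      ring
  · exact (dualSubmodule_ne_zpow_odd_smul hT0 halt hv huv h hϖ hu s hc).elim

end SkewAdjoint

section ScalarRootsOfUnity

variable {K L V G : Type*} [Field K] [Field L] [AddCommGroup V] [Module K V] [Module L V]

theorem apply_sub_smul_left {f : LinearMap.BilinForm K V} {ζ ξ : L} (hζξ : ζ * ξ = 1)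
    (hf : ∀ x y, f (ζ • x) (ζ • y) = f x y) (x y : V) :
    f ((ζ - ξ) • x) y = f x (-(ζ - ξ) • y) := by
  have hζ : f (ζ • x) y = f x (ξ • y) := by rw [← hf x, smul_smul, hζξ, one_smul]
  have hξ : f (ξ • x) y = f x (ζ • y) := by rw [← hf (ξ • x), smul_smul, hζξ, one_smul]
  rw [sub_smul, map_sub, LinearMap.sub_apply, hζ, hξ, neg_sub, sub_smul, map_sub]

variable [Group G] [Finite G] {ρ : Representation K G V}

theorem exists_isPrimitiveRoot_eq_smul (hfaithful : Function.Injective ρ) {ℓ : ℕ} (hℓ : ℓ.Prime)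
    (hcard : ℓ ∣ Nat.card G) [Nontrivial V] (hscalar : ∀ g, ∃ a : L, ∀ x, ρ g x = a • x) :
    ∃ (σ : G) (ζ : L), IsPrimitiveRoot ζ ℓ ∧ ∀ x, ρ σ x = ζ • x := by
  have := Fact.mk hℓ
  obtain ⟨σ, hσ⟩ := exists_prime_orderOf_dvd_card' ℓ hcard
  obtain ⟨ζ, hζ⟩ := hscalar σ
  have hpow (k : ℕ) (x : V) : ρ (σ ^ k) x = ζ ^ k • x := by
    induction k with
    | zero => simp
    | succ k ih => rw [pow_succ', map_mul, Module.End.mul_apply, ih, hζ, smul_smul, pow_succ']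
  have hiff (k : ℕ) : ζ ^ k = 1 ↔ σ ^ k = 1 := by
    constructor
    · refine fun h ↦ hfaithful (LinearMap.ext fun x ↦ ?_)
      rw [hpow, h, one_smul, map_one, Module.End.one_apply]
    · intro h
      obtain ⟨x, hx⟩ := exists_ne (0 : V)
      refine smul_left_injective L hx ?_
      simp only [← hpow, h, map_one, Module.End.one_apply, one_smul]
  refine ⟨σ, ζ, ?_, hζ⟩
  rw [← hσ, ← orderOf_eq_orderOf_iff.2 hiff]
  exact IsPrimitiveRoot.orderOf ζ

variable {O : Type*} [CommRing O] [Algebra O K] [Algebra O L] [Algebra K L] [Module O V]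
  [IsScalarTower O K V] [IsScalarTower O L V] [IsScalarTower K L V] [FiniteDimensional K V]

variable (O) in
theorem exists_isLattice_stable_mem_multiplierRing (hρ : ∀ g (a : L) x, ρ g (a • x) = a • ρ g x)
    {ζ : L} {ℓ : ℕ} [NeZero ℓ] (hζ : IsPrimitiveRoot ζ ℓ) :
    ∃ T : Submodule O V, T.IsLattice K ∧ (∀ g, ∀ x ∈ T, ρ g x ∈ T) ∧ ζ ∈ multiplierRing L T := by
  let scalars : Representation K (rootsOfUnity ℓ L) V :=
    DistribMulAction.toModuleEnd K V
  have hcomm (g : G) (w : rootsOfUnity ℓ L) : Commute (ρ g) (scalars w) :=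
    LinearMap.ext fun x ↦ hρ g _ x
  obtain ⟨T, hT, hstable⟩ := exists_isLattice_stable O (MonoidHom.noncommCoprod ρ scalars hcomm)
  refine ⟨T, hT, fun g x hx ↦ ?_, fun x hx ↦ ?_⟩
  · simpa using hstable (g, 1) x hx
  · have := hstable (1, hζ.toRootsOfUnity) x hx
    rwa [MonoidHom.noncommCoprod_apply, map_one, one_mul] at this

variable [IsDomain O] [IsDiscreteValuationRing O] [IsFractionRing O K]

theorem hasUnimodularLattice_of_isPrimitiveRoot [Nontrivial V] (hfaithful : Function.Injective ρ)
    {f : LinearMap.BilinForm K V} (hf : f.Nondegenerate) (halt : f.IsAlt)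
    (hinv : ∀ g x y, f (ρ g x) (ρ g y) = f x y) {ϖ : O} (hϖ : Irreducible ϖ) {ℓ e d : ℕ}
    (hℓ : ℓ.Prime) (hodd : Odd ℓ) (he0 : e ≠ 0) (hV : Module.finrank K V = 2 * d)
    (he : Associated (ℓ : O) (ϖ ^ e)) (hlt : d * e + 1 < ℓ) (hcard : ℓ ∣ Nat.card G)
    (hρ : ∀ g (a : L) x, ρ g (a • x) = a • ρ g x) {ζ₀ : L} (hζ₀ : IsPrimitiveRoot ζ₀ ℓ) :
    HasUnimodularLattice O ρ := by
  have := NeZero.mk hℓ.ne_zero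
  have hunit {ζ : L} (hζ : IsPrimitiveRoot ζ ℓ) : IsUnit (ζ - ζ ^ (ℓ - 1)) :=
    (sub_pow_ne_zero_of_isPrimitiveRoot hℓ.one_lt hodd hζ).isUnit
  obtain ⟨T, hT, hstable, hζ₀T⟩ := exists_isLattice_stable_mem_multiplierRing O hρ hζ₀
  have hunif {ζ : L} (hζ : IsPrimitiveRoot ζ ℓ) {u : Lˣ} (hu : (u : L) = ζ - ζ ^ (ℓ - 1)) :
      IsUniserial u {S | u • S ≤ S} T ∧ u ^ (ℓ - 1) • T ≤ ϖ • T := by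
    have hζT : ζ ∈ multiplierRing L T := by
      obtain ⟨i, -, rfl⟩ := hζ₀.eq_pow_of_pow_eq_one hζ.pow_eq_one
      exact pow_mem hζ₀T i
    exact isUniserial_of_isPrimitiveRoot hϖ hℓ hodd he0 hV he hlt hζ hζT hu
  have hdim : Module.finrank L V = 1 := by
    obtain ⟨u₀, hu₀⟩ := hunit hζ₀
    exact (hunif hζ₀ hu₀).1.finrank_eq_one (K := K) hϖ (hunif hζ₀ hu₀).2
  obtain ⟨σ, ζ, hζ, hσ⟩ := exists_isPrimitiveRoot_eq_smul hfaithful hℓ hcard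
    fun g ↦ exists_eq_smul_of_commute_smul hdim (map_add (ρ g)) (hρ g)
  obtain ⟨u, hu⟩ := hunit hζ
  have hskew (x y : V) : f (u • x) y = f x (-u • y) := by
    simp only [Units.smul_def, Units.val_neg, hu]
    refine apply_sub_smul_left ?_ (fun x y ↦ by rw [← hσ, ← hσ, hinv]) x y
    rw [mul_pow_sub_one hℓ.ne_zero, hζ.pow_eq_one]
  have hneg (x : V) : -u • x = -(u • x) := by
    simp only [Units.smul_def, Units.val_neg, neg_smul]
  have hρ' (g : G) (a : Lˣ) (x : V) : ρ g (a • x) = a • ρ g x := hρ g a x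
  obtain ⟨huni, hsmall⟩ := hunif hζ hu
  exact hasUnimodularLattice_of_skewAdjoint hf halt hinv hstable hρ' hneg hskew huni hϖ
    hsmall

end ScalarRootsOfUnity

section Schur

universe w

variable {K G : Type*} {V : Type w} [Field K] [AddCommGroup V] [Module K V]
  [FiniteDimensional K V] [Group G] {ρ : Representation K G V}

theorem isUnit_of_commute_of_ne_zero (hirr : ρ.IsIrreducible) {A : Module.End K V}
    (hA : ∀ g, Commute A (ρ g)) (hA0 : A ≠ 0) : IsUnit A := by
  have hker : LinearMap.ker A = ⊥ := by
    refine (eq_bot_or_eq_top_of_stable hirr fun g x hx ↦ ?_).resolve_right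
      fun htop ↦ hA0 (LinearMap.ker_eq_top.1 htop)
    have hAx : A (ρ g x) = ρ g (A x) := LinearMap.congr_fun (hA g) x
    rw [LinearMap.mem_ker, hAx, LinearMap.mem_ker.1 hx, map_zero]
  exact (LinearMap.isUnit_iff_ker_eq_bot A).2 hker

theorem exists_field_of_commute (hirr : ρ.IsIrreducible) {z : Module.End K V}
    (hz : ∀ g, Commute z (ρ g)) :
    ∃ (L : Type w) (_ : Field L) (_ : Algebra K L) (φ : L →ₐ[K] Module.End K V),
      (∀ a g, Commute (φ a) (ρ g)) ∧ ∃ a, φ a = z := by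
  have := nontrivial_of_isIrreducible hirr
  let L := Algebra.adjoin K {z}
  have hL (a : L) (g : G) : Commute (a : Module.End K V) (ρ g) := by
    have hle : L ≤ Subalgebra.centralizer K {ρ g} :=
      Algebra.adjoin_le (Set.singleton_subset_iff.2 fun _ h ↦ h ▸ (hz g).symm)
    exact (hle a.2 (ρ g) rfl).symm
  have : NoZeroDivisors L := ⟨fun {a b} hab ↦ by
    refine or_iff_not_imp_left.2 fun ha ↦ Subtype.ext ?_
    have ha0 : (a : Module.End K V) ≠ 0 := fun h ↦ ha (Subtype.ext h)
    exact (isUnit_of_commute_of_ne_zero hirr (hL a) ha0).mul_right_eq_zero.1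
      (congrArg Subtype.val hab)⟩
  have := NoZeroDivisors.to_isDomain L
  exact ⟨L, fieldOfFiniteDimensional K L, _, L.val, hL,
    ⟨z, Algebra.self_mem_adjoin_singleton K z⟩, rfl⟩

theorem hasUnimodularLattice_of_commute_of_orderOf_eq {O : Type*} [CommRing O] [IsDomain O]
    [IsDiscreteValuationRing O] [Algebra O K] [IsFractionRing O K] [Module O V]
    [IsScalarTower O K V] [Finite G] {f : LinearMap.BilinForm K V} {ϖ : O} {ℓ d e : ℕ}
    (hirr : ρ.IsIrreducible) (hfaithful : Function.Injective ρ) (hf : f.Nondegenerate)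
    (halt : f.IsAlt) (hinv : ∀ g x y, f (ρ g x) (ρ g y) = f x y) (hϖ : Irreducible ϖ)
    (hℓ : ℓ.Prime) (hodd : Odd ℓ) (he0 : e ≠ 0) (hV : Module.finrank K V = 2 * d)
    (he : Associated (ℓ : O) (ϖ ^ e)) (hlt : d * e + 1 < ℓ) (hcard : ℓ ∣ Nat.card G)
    {z : Module.End K V} (hz : ∀ g, Commute z (ρ g)) (horder : orderOf z = ℓ) :
    HasUnimodularLattice O ρ := by
  have := nontrivial_of_isIrreducible hirr
  obtain ⟨L, _, _, φ, hφ, ζ₀, rfl⟩ := exists_field_of_commute hirr hz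
  let _ : Module L V := Module.compHom V φ.toRingHom
  let _ : Algebra O L := ((algebraMap K L).comp (algebraMap O K)).toAlgebra
  have hsmul (a : L) (x : V) : a • x = φ a x := rfl
  have : IsScalarTower K L V := ⟨fun k a x ↦ by
    rw [hsmul, hsmul, map_smul, LinearMap.smul_apply]⟩
  have : IsScalarTower O K L := .of_algebraMap_eq fun _ ↦ rfl
  have : IsScalarTower O L V := ⟨fun k a x ↦ by
    rw [← algebraMap_smul K k a, smul_assoc, algebraMap_smul]⟩
  have hζ₀ : orderOf ζ₀ = ℓ :=
    horder ▸ (orderOf_injective (φ : L →* Module.End K V) φ.toRingHom.injective ζ₀).symm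
  have hρ (g : G) (a : L) (x : V) : ρ g (a • x) = a • ρ g x :=
    (LinearMap.congr_fun (hφ a g) x).symm
  exact hasUnimodularLattice_of_isPrimitiveRoot hfaithful hf halt hinv hϖ hℓ hodd he0 hV he hlt
    hcard hρ (hζ₀ ▸ IsPrimitiveRoot.orderOf ζ₀)

end Schur

section Roots

theorem exists_pow_eq_of_coprime {M : Type*} [CommGroupWithZero M] {a b : M} (ha : a ≠ 0)
    {m n : ℕ} (hmn : m.Coprime n) (h : b ^ n = a ^ m) : ∃ c, c ^ n = a := by
  have hbezout : (m : ℤ) * m.gcdA n + n * m.gcdB n = 1 := by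
    rw [← Nat.gcd_eq_gcd_ab, hmn, Nat.cast_one]
  refine ⟨b ^ m.gcdA n * a ^ m.gcdB n, ?_⟩
  calc (b ^ m.gcdA n * a ^ m.gcdB n) ^ n
      = (b ^ n) ^ m.gcdA n * a ^ (n * m.gcdB n) := by
        rw [mul_pow]
        simp only [← zpow_natCast, ← zpow_mul, mul_comm (n : ℤ)]
    _ = a ^ (m * m.gcdA n + n * m.gcdB n) := by
        rw [h, zpow_add₀ ha, zpow_mul a m, zpow_natCast]
    _ = a := by rw [hbezout, zpow_one]

theorem exists_pow_eq_of_end_pow_eq_smul {F V : Type*} [Field F] [AddCommGroup V] [Module F V]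
    {n : ℕ} (hn : (Module.finrank F V).Coprime n) {b : Module.End F V} {a : F} (ha : a ≠ 0)
    (h : b ^ n = a • 1) : ∃ c, c ^ n = a := by
  refine exists_pow_eq_of_coprime ha hn (b := LinearMap.det b) ?_
  rw [← map_pow, h, LinearMap.det_smul, map_one, mul_one]

theorem algEquiv_eq_one_of_pow_prime_pow_eq_one {K F : Type*} [Field K] [Field F] [Algebra K F]
    [FiniteDimensional K F] {ℓ m : ℕ} (hℓ : ℓ.Prime) (hdim : ¬ ℓ ∣ Module.finrank K F)
    {τ : F ≃ₐ[K] F} (hτ : τ ^ ℓ ^ m = 1) : τ = 1 := by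
  have hdvd : orderOf τ ∣ Module.finrank K F := by
    rw [← Nat.card_zpowers, ← IntermediateField.finrank_fixedField_eq_card,
      ← Module.finrank_mul_finrank K (IntermediateField.fixedField (Subgroup.zpowers τ)) F]
    exact dvd_mul_left _ _
  have hcoprime : (ℓ ^ m).Coprime (orderOf τ) := Nat.Coprime.pow_left m
    ((hℓ.coprime_iff_not_dvd).2 fun h ↦ hdim (h.trans hdvd))
  exact orderOf_eq_one_iff.1 (hcoprime.symm.eq_one_of_dvd (orderOf_dvd_of_pow_eq_one hτ))

end Roots

section Center

variable {K F V : Type*} [Field K] [Field F] [Algebra K F] [AddCommGroup V] [Module K V]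

theorem finrank_dvd_finrank_of_algHom_end (s : F →ₐ[K] Module.End K V) :
    Module.finrank K F ∣ Module.finrank K V := by
  let _ : Module F V := Module.compHom V s.toRingHom
  have : IsScalarTower K F V := ⟨fun k c v ↦ LinearMap.congr_fun (map_smul s k c) v⟩
  exact Dvd.intro _ (Module.finrank_mul_finrank K F V)

theorem exists_pow_eq_of_commute_of_pow_eq (s : F →ₐ[K] Module.End K V) {b : Module.End K V}
    (hb : ∀ a, Commute b (s a)) {n : ℕ} (hn : (Module.finrank K V).Coprime n) {f : F}
    (hf0 : f ≠ 0) (hf : s f = b ^ n) : ∃ c, c ^ n = f := by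
  let _ : Module F V := Module.compHom V s.toRingHom
  have : IsScalarTower K F V := ⟨fun k c v ↦ LinearMap.congr_fun (map_smul s k c) v⟩
  let bF : Module.End F V :=
    { b with map_smul' := fun c v ↦ LinearMap.congr_fun (hb c) v }
  have hbF : bF ^ n = f • 1 := LinearMap.ext fun v ↦ by
    have hpow : (bF ^ n) v = (b ^ n) v := by
      rw [Module.End.pow_apply, Module.End.pow_apply]; rfl
    rw [hpow, ← hf]; rfl
  exact exists_pow_eq_of_end_pow_eq_smul
    (hn.coprime_dvd_left (Dvd.intro_left _ (Module.finrank_mul_finrank K F V))) hf0 hbF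

end Center

section CentralSimple

variable {K F A E : Type*} [Field K] [Field F] [Algebra K F] [Ring A] [Algebra K A] [Algebra F A]
  [IsScalarTower K F A] [Ring E] [Algebra K E]

theorem exists_algEquiv_forall_mul_eq [FiniteDimensional K A] {Ψ : A →ₐ[K] E}
    (hΨ : Function.Injective Ψ) (c : Eˣ) (hc : ∀ x, ∃ y, c * Ψ x = Ψ y * c) :
    ∃ φ : A ≃ₐ[K] A, ∀ x, c * Ψ x = Ψ (φ x) * c := by
  have hrange (x : A) : c * Ψ x * ↑c⁻¹ ∈ Ψ.range := by
    obtain ⟨y, hy⟩ := hc x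
    exact ⟨y, ((Units.eq_mul_inv_iff_mul_eq c).2 hy.symm)⟩
  let conj : A →ₐ[K] E := (MulSemiringAction.toAlgHom K E (ConjAct.toConjAct c)).comp Ψ
  let φ : A →ₐ[K] A := (AlgEquiv.ofInjective Ψ hΨ).symm.toAlgHom.comp (conj.codRestrict _ hrange)
  have hφ (x : A) : Ψ (φ x) = c * Ψ x * ↑c⁻¹ :=
    congrArg Subtype.val ((AlgEquiv.ofInjective Ψ hΨ).apply_symm_apply ⟨_, hrange x⟩)
  have hinj : Function.Injective φ := fun x y hxy ↦ by
    have := hφ x ▸ hφ y ▸ congrArg Ψ hxy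
    exact hΨ (by simpa using this)
  have hbij : Function.Bijective φ :=
    ⟨hinj, LinearMap.surjective_of_injective (f := φ.toLinearMap) hinj⟩
  exact ⟨.ofBijective φ hbij, fun x ↦ ((Units.eq_mul_inv_iff_mul_eq c).1 (hφ x)).symm⟩

variable [Algebra.IsCentral F A]

theorem exists_algebraMap_eq_of_forall_commute {y : A} (hy : ∀ x, Commute x y) :
    ∃ a, algebraMap F A a = y :=
  ((Algebra.IsCentral.mem_center_iff F).1 (Subalgebra.mem_center_iff.2 hy)).imp fun _ ↦ Eq.symm

theorem exists_algebraMap_eq_pow_of_commute {Ψ : A →+* E} (hΨ : Function.Injective Ψ) {a : Aˣ}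
    {b : E} (hb : ∀ x, Commute b (Ψ x)) {k : ℕ} (hpow : ∃ y, Ψ y = (Ψ a * b) ^ k) :
    ∃ f : F, Ψ (algebraMap F A f) = b ^ k := by
  obtain ⟨y, hy⟩ := hpow
  have hrange : Ψ (↑(a ^ k)⁻¹ * y) = b ^ k := by
    rw [map_mul, hy, (hb a).symm.mul_pow, ← map_pow, ← mul_assoc, ← map_mul,
      ← Units.val_pow_eq_pow_val, Units.inv_mul, map_one, one_mul]
  obtain ⟨f, hf⟩ := exists_algebraMap_eq_of_forall_commute (F := F) (y := ↑(a ^ k)⁻¹ * y)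
    fun x ↦ hΨ <| by rw [map_mul Ψ x, map_mul Ψ _ x, hrange, ((hb x).pow_left k).eq]
  exact ⟨f, by rw [hf, hrange]⟩

variable [Nontrivial A]

theorem exists_algEquiv_algebraMap_eq [FiniteDimensional K F] (φ : A ≃ₐ[K] A) :
    ∃ τ : F ≃ₐ[K] F, ∀ a, φ (algebraMap F A a) = algebraMap F A (τ a) := by
  let s : F →ₐ[K] A := IsScalarTower.toAlgHom K F A
  have hs : Function.Injective s := (algebraMap F A).injective
  have hrange (a : F) : φ (s a) ∈ s.range := by
    refine exists_algebraMap_eq_of_forall_commute (F := F) fun x ↦ ?_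
    obtain ⟨x, rfl⟩ := φ.surjective x
    exact Commute.map (Algebra.commutes a x).symm φ
  let τ : F →ₐ[K] F := (AlgEquiv.ofInjective s hs).symm.toAlgHom.comp
    ((φ.toAlgHom.comp s).codRestrict _ hrange)
  have hτ (a : F) : s (τ a) = φ (s a) :=
    congrArg Subtype.val ((AlgEquiv.ofInjective s hs).apply_symm_apply ⟨_, hrange a⟩)
  exact ⟨.ofBijective τ (Algebra.IsAlgebraic.algHom_bijective τ), fun a ↦ (hτ a).symm⟩

theorem algEquiv_apply_algebraMap_eq_of_pow [FiniteDimensional K F] {ℓ m : ℕ} (hℓ : ℓ.Prime)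
    (hdim : ¬ ℓ ∣ Module.finrank K F) {φ : A ≃ₐ[K] A}
    (hφ : ∀ a, (φ ^ ℓ ^ m) (algebraMap F A a) = algebraMap F A a) (a : F) :
    φ (algebraMap F A a) = algebraMap F A a := by
  obtain ⟨τ, hτ⟩ := exists_algEquiv_algebraMap_eq (F := F) φ
  have hpow (k : ℕ) (a : F) : (φ ^ k) (algebraMap F A a) = algebraMap F A ((τ ^ k) a) := by
    induction k with
    | zero => rfl
    | succ k ih => rw [pow_succ', AlgEquiv.mul_apply, ih, hτ, pow_succ', AlgEquiv.mul_apply]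
  have hτ1 : τ = 1 := algEquiv_eq_one_of_pow_prime_pow_eq_one hℓ hdim <| AlgEquiv.ext fun a ↦
    (algebraMap F A).injective ((hpow _ a).symm.trans (hφ a))
  rw [hτ, hτ1, AlgEquiv.one_apply]

end CentralSimple

section MatrixAlgebra

variable {n F : Type*} [Fintype n] [DecidableEq n] [Field F]

theorem exists_units_forall_algEquiv_eq_conj (φ : Matrix n n F ≃ₐ[F] Matrix n n F) :
    ∃ a : (Matrix n n F)ˣ, ∀ x, φ x = a * x * (a⁻¹ : (Matrix n n F)ˣ) := by
  let e : Matrix n n F ≃ₐ[F] Module.End F (n → F) := Matrix.toLinAlgEquiv'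
  obtain ⟨t, ht⟩ := Module.End.mulSemiringActionToAlgEquiv_conjAct_surjective
    ((e.symm.trans φ).trans e)
  have hconj (y : Module.End F (n → F)) : e (φ (e.symm y)) = ConjAct.ofConjAct t * y *
      ((ConjAct.ofConjAct t)⁻¹ : (Module.End F (n → F))ˣ) := (DFunLike.congr_fun ht y).symm
  refine ⟨Units.map e.symm.toMonoidHom (ConjAct.ofConjAct t), fun x ↦ ?_⟩
  have hx := congrArg e.symm (hconj (e x))
  rwa [e.symm_apply_apply, e.symm_apply_apply, map_mul, map_mul, e.symm_apply_apply] at hx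

variable [Nonempty n] {K : Type*} [Field K] [Algebra K F]

theorem exists_units_forall_commute_mul [FiniteDimensional K F] {E : Type*} [Ring E] [Algebra K E]
    {Ψ : Matrix n n F →ₐ[K] E} (hΨ : Function.Injective Ψ) {ℓ m : ℕ} (hℓ : ℓ.Prime)
    (hdim : ¬ ℓ ∣ Module.finrank K F) (c : Eˣ)
    (hc : ∀ x, ∃ y, c * Ψ x = Ψ y * c) (hpow : ∃ y, Ψ y = c ^ ℓ ^ m) :
    ∃ a : (Matrix n n F)ˣ, ∀ x, Commute (Ψ (a⁻¹ : (Matrix n n F)ˣ) * c) (Ψ x) := by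
  obtain ⟨φ, hφ⟩ := exists_algEquiv_forall_mul_eq hΨ c hc
  have hφpow (k : ℕ) (x) : c ^ k * Ψ x = Ψ ((φ ^ k) x) * c ^ k := by
    induction k with
    | zero => simp
    | succ k ih => rw [pow_succ', mul_assoc, ih, ← mul_assoc, hφ, mul_assoc, pow_succ' φ]; rfl
  have hcenter (a : F) : φ (algebraMap F _ a) = algebraMap F _ a := by
    refine algEquiv_apply_algebraMap_eq_of_pow hℓ hdim (m := m) (fun a ↦ hΨ ?_) a
    obtain ⟨y, hy⟩ := hpow
    have hcomm : c ^ ℓ ^ m * Ψ (algebraMap F _ a) = Ψ (algebraMap F _ a) * c ^ ℓ ^ m := by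
      rw [← hy, ← map_mul, ← map_mul, Algebra.commutes]
    exact (c ^ ℓ ^ m).isUnit.mul_right_cancel (by
      rw [Units.val_pow_eq_pow_val, ← hφpow, hcomm])
  obtain ⟨a, ha⟩ := exists_units_forall_algEquiv_eq_conj
    (AlgEquiv.ofRingEquiv (f := φ.toRingEquiv) hcenter)
  replace ha (x) : φ x = a * x * (a⁻¹ : (Matrix n n F)ˣ) := ha x
  refine ⟨a, fun x ↦ ?_⟩
  rw [commute_iff_eq, mul_assoc, hφ, ha, ← mul_assoc, ← map_mul, ← mul_assoc, ← mul_assoc,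
    Units.inv_mul, one_mul, map_mul, mul_assoc]

theorem exists_eq_mul_of_normalizes_range {V : Type*} [AddCommGroup V] [Module K V]
    [FiniteDimensional K V] {Ψ : Matrix n n F →ₐ[K] Module.End K V} (hΨ : Function.Injective Ψ)
    {ℓ m : ℕ} (hℓ : ℓ.Prime) (hdim : ¬ ℓ ∣ Module.finrank K V) (c : (Module.End K V)ˣ)
    (hc : ∀ x, ∃ y, c * Ψ x = Ψ y * c) (hpow : ∃ y, Ψ y = c ^ ℓ ^ m) :
    ∃ (x : Matrix n n F) (β : Module.End K V),
      c = Ψ x * β ∧ β ^ ℓ ^ m = 1 ∧ ∀ y, Commute β (Ψ y) := by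
  let s : F →ₐ[K] Module.End K V := Ψ.comp (IsScalarTower.toAlgHom K F _)
  have hsinj : Function.Injective s := hΨ.comp (algebraMap F (Matrix n n F)).injective
  have hscomm (a x) : Commute (s a) (Ψ x) := (show Commute _ x from Algebra.commutes a x).map Ψ
  have : FiniteDimensional K F := Module.Finite.of_injective s.toLinearMap hsinj
  obtain ⟨a, ha⟩ := exists_units_forall_commute_mul hΨ hℓ
    (fun h ↦ hdim (h.trans (finrank_dvd_finrank_of_algHom_end s))) c hc hpow
  set b := Ψ (a⁻¹ : (Matrix n n F)ˣ) * c
  have hab : (c : Module.End K V) = Ψ a * b := by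
    rw [← mul_assoc, ← map_mul, Units.mul_inv, map_one, one_mul]
  obtain ⟨f, hf : s f = b ^ ℓ ^ m⟩ :=
    exists_algebraMap_eq_pow_of_commute (F := F) (Ψ := Ψ.toRingHom) hΨ ha (hab ▸ hpow)
  have hf0 : f ≠ 0 := by
    rintro rfl
    have hunit : IsUnit (b ^ ℓ ^ m) := ((Units.map Ψ.toMonoidHom a⁻¹ * c) ^ ℓ ^ m).isUnit
    rw [← hf, map_zero, isUnit_zero_iff, ← map_zero Ψ, ← map_one Ψ] at hunit
    exact zero_ne_one (hΨ hunit)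
  obtain ⟨μ, rfl⟩ := exists_pow_eq_of_commute_of_pow_eq s (fun _ ↦ ha _)
    ((hℓ.coprime_iff_not_dvd.2 hdim).symm.pow_right m) hf0 hf
  have hμ0 : μ ≠ 0 := ne_zero_pow (pow_ne_zero m hℓ.ne_zero) hf0
  have hμ : s μ * s μ⁻¹ = 1 := by rw [← map_mul, mul_inv_cancel₀ hμ0, map_one]
  refine ⟨a * algebraMap F _ μ, s μ⁻¹ * b, ?_, ?_, fun y ↦ (hscomm _ y).mul_left (ha y)⟩
  · rw [hab, map_mul, mul_assoc, ← mul_assoc _ (s μ⁻¹)]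
    exact congrArg (Ψ a * ·) ((one_mul b).symm.trans (congrArg (· * b) hμ.symm))
  · rw [(show Commute (s μ⁻¹) b from (ha _).symm).mul_pow, ← hf, map_pow,
      ← ((Commute.all μ⁻¹ μ).map s).mul_pow, ← map_mul, inv_mul_cancel₀ hμ0, map_one, one_pow]

end MatrixAlgebra

section CentrallyPrimitive

/-- A centrally primitive idempotent: a minimal nonzero idempotent of the centre, that is, the unit
of an indecomposable block of the ring. -/
structure IsCentrallyPrimitive {R : Type*} [Ring R] (e : R) : Prop where
  mem_center : e ∈ Subring.center R
  isIdempotentElem : IsIdempotentElem e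
  ne_zero : e ≠ 0
  mul_eq_zero_or_eq :
    ∀ z ∈ Subring.center R, IsIdempotentElem z → z * e = 0 ∨ z * e = e

theorem IsCentrallyPrimitive.map_ringEquiv {R S : Type*} [Ring R] [Ring S] {e : R}
    (he : IsCentrallyPrimitive e) (σ : R ≃+* S) : IsCentrallyPrimitive (σ e) where
  mem_center := Subring.mem_center_iff.2 fun x ↦ by
    rw [← σ.apply_symm_apply x, ← map_mul, ← map_mul, Subring.mem_center_iff.1 he.mem_center]
  isIdempotentElem := he.isIdempotentElem.map σ
  ne_zero := (map_ne_zero_iff σ σ.injective).2 he.ne_zero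
  mul_eq_zero_or_eq z hz hzz := by
    have hcenter : σ.symm z ∈ Subring.center R := Subring.mem_center_iff.2 fun x ↦ by
      rw [← σ.symm_apply_apply x, ← map_mul, ← map_mul, Subring.mem_center_iff.1 hz]
    have hmul : σ (σ.symm z * e) = z * σ e := by rw [map_mul, σ.apply_symm_apply]
    rw [← hmul]
    exact (he.mul_eq_zero_or_eq _ hcenter (hzz.map σ.symm)).imp
      (fun h ↦ by rw [h, map_zero]) (fun h ↦ by rw [h])

theorem IsCentrallyPrimitive.mul_eq_zero_of_ne {R : Type*} [Ring R] {e f : R}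
    (he : IsCentrallyPrimitive e) (hf : IsCentrallyPrimitive f) (hef : e ≠ f) : e * f = 0 := by
  have hcomm : e * f = f * e := Subring.mem_center_iff.1 hf.mem_center e
  refine (hf.mul_eq_zero_or_eq e he.mem_center he.isIdempotentElem).resolve_right fun h ↦ ?_
  rcases he.mul_eq_zero_or_eq f hf.mem_center hf.isIdempotentElem with h0 | h1
  · exact hf.ne_zero (h.symm.trans (hcomm.trans h0))
  · exact hef (h1.symm.trans (hcomm.symm.trans h))

theorem isCentrallyPrimitive_single {ι : Type*} [DecidableEq ι] {F A : ι → Type*}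
    [∀ i, Field (F i)] [∀ i, Ring (A i)] [∀ i, Algebra (F i) (A i)]
    [∀ i, Algebra.IsCentral (F i) (A i)] (i : ι) [Nontrivial (A i)] :
    IsCentrallyPrimitive (Pi.single i 1 : Π i, A i) where
  mem_center := Subring.mem_center_iff.2 fun x ↦ by
    rw [← Pi.single_mul_left, ← Pi.single_mul_right, one_mul, mul_one]
  isIdempotentElem := by
    rw [IsIdempotentElem, ← Pi.single_mul, one_mul]
  ne_zero := by rw [Ne, Pi.single_eq_zero_iff]; exact one_ne_zero
  mul_eq_zero_or_eq z hz hzz := by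
    have hcenter (x : A i) : x * z i = z i * x := by
      simpa using congrFun (Subring.mem_center_iff.1 hz (Pi.single i x)) i
    obtain ⟨c, hc⟩ := (Algebra.IsCentral.mem_center_iff (F i)).1
      (Subalgebra.mem_center_iff.2 hcenter)
    have hcc : IsIdempotentElem c := (algebraMap (F i) (A i)).injective <| by
      rw [map_mul, ← hc]; exact congrFun hzz i
    rw [← Pi.single_mul_right, mul_one, hc]
    exact (IsIdempotentElem.iff_eq_zero_or_one.1 hcc).imp
      (fun h ↦ by rw [h, map_zero, Pi.single_zero]) (fun h ↦ by rw [h, map_one])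

end CentrallyPrimitive

section Block

theorem exists_algHom_of_map_single_eq_one {K ι E : Type*} [CommSemiring K] [DecidableEq ι]
    {A : ι → Type*} [∀ i, Semiring (A i)] [∀ i, Algebra K (A i)] [Semiring E] [Algebra K E]
    (Θ : (Π i, A i) →ₐ[K] E) {i : ι} (hi : Θ (Pi.single i 1) = 1) :
    ∃ Ψ : A i →ₐ[K] E, ∀ x, Θ x = Ψ (x i) := by
  let Ψ : A i →ₐ[K] E := .ofLinearMap (Θ.toLinearMap ∘ₗ LinearMap.single K A i) hi fun x y ↦ by
    simp [Pi.single_mul]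
  refine ⟨Ψ, fun x ↦ ?_⟩
  calc Θ x = Θ (Pi.single i 1 * x) := by rw [map_mul, hi, one_mul]
    _ = Θ (Pi.single i (x i)) := by rw [← Pi.single_mul_left, one_mul]

end Block

section OrbitOfIdempotents

variable {K G V ι : Type*} [Field K] [Group G] [AddCommGroup V] [Module K V]
  [FiniteDimensional K V] {ρ : Representation K G V} [Fintype ι] [MulAction G ι]
  {u : ι → Module.End K V}

theorem sum_eq_one_of_orthogonalIdempotents (hirr : ρ.IsIrreducible)
    (hu : OrthogonalIdempotents u) (hρ : ∀ g i, ρ g * u i = u (g • i) * ρ g) {i : ι}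
    (hi : u i ≠ 0) : ∑ j, u j = 1 := by
  have hcomm (g : G) : Commute (∑ j, u j) (ρ g) := by
    rw [commute_iff_eq, Finset.mul_sum, Finset.sum_mul, ← Equiv.sum_comp (MulAction.toPerm g)]
    exact Finset.sum_congr rfl fun j _ ↦ (hρ g j).symm
  have hne : ∑ j, u j ≠ 0 := fun h ↦ hi <| by
    rw [← hu.mul_sum_of_mem (Finset.mem_univ i), h, mul_zero]
  exact (IsIdempotentElem.iff_eq_one_of_isUnit (isUnit_of_commute_of_ne_zero hirr hcomm hne)).1
    hu.isIdempotentElem_sum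

theorem finrank_eq_card_mul_finrank_range [CharZero K] [MulAction.IsPretransitive G ι]
    (hu : ∀ i, IsIdempotentElem (u i)) (hsum : ∑ j, u j = 1)
    (hρ : ∀ g i, ρ g * u i = u (g • i) * ρ g) (i : ι) :
    Module.finrank K V = Fintype.card ι * Module.finrank K (LinearMap.range (u i)) := by
  have htrace (j : ι) : LinearMap.trace K V (u j) = LinearMap.trace K V (u i) := by
    obtain ⟨g, rfl⟩ := MulAction.exists_smul_eq G i j
    have hconj : u (g • i) = ρ g * u i * ρ g⁻¹ := by
      rw [hρ, mul_assoc, ← map_mul, mul_inv_cancel, map_one, mul_one]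
    rw [hconj, LinearMap.trace_mul_comm, ← mul_assoc, ← map_mul, inv_mul_cancel, map_one, one_mul]
  have hone := congrArg (LinearMap.trace K V) hsum
  rw [map_sum, Finset.sum_congr rfl fun j _ ↦ htrace j, Finset.sum_const, LinearMap.trace_one,
    ((LinearMap.isProj_range_iff_isIdempotentElem _).2 (hu i)).trace, nsmul_eq_mul] at hone
  exact_mod_cast hone.symm

end OrbitOfIdempotents

section GroupAlgebra

variable {K G V : Type*} [Field K] [Group G] [AddCommGroup V] [Module K V]
  (ρ : Representation K G V) (N : Subgroup G)

section Conj

variable [N.Normal]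

variable (K) in
/-- The action of a group on the group algebra of a normal subgroup by conjugation. -/
noncomputable def conjMonoidAlgebra : G →* (MonoidAlgebra K N ≃ₐ[K] MonoidAlgebra K N) :=
  (MonoidAlgebra.domCongrAut (R := K) (A := K)).comp MulAut.conjNormal

theorem conjMonoidAlgebra_of (g : G) (n : N) :
    conjMonoidAlgebra K N g (MonoidAlgebra.of K N n) =
      MonoidAlgebra.of K N (MulAut.conjNormal g n) := by
  simp [conjMonoidAlgebra]

theorem mul_asAlgebraHom_eq (g : G) (y : MonoidAlgebra K N) :
    ρ g * Representation.asAlgebraHom (ρ.comp N.subtype) y =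
      Representation.asAlgebraHom (ρ.comp N.subtype) (conjMonoidAlgebra K N g y) * ρ g := by
  induction y using MonoidAlgebra.induction_on with
  | of n =>
    rw [conjMonoidAlgebra_of, Representation.asAlgebraHom_of, Representation.asAlgebraHom_of]
    change ρ g * ρ n = ρ (g * n * g⁻¹) * ρ g
    rw [← map_mul, ← map_mul, inv_mul_cancel_right]
  | add a b ha hb => rw [map_add, map_add, map_add, mul_add, add_mul, ha, hb]
  | smul c a ha => rw [map_smul, map_smul, map_smul, mul_smul_comm, smul_mul_assoc, ha]

theorem conjMonoidAlgebra_mul_of (n : N) (y : MonoidAlgebra K N) :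
    conjMonoidAlgebra K N n y * MonoidAlgebra.of K N n = MonoidAlgebra.of K N n * y := by
  induction y using MonoidAlgebra.induction_on with
  | of k =>
    have hconj : MulAut.conjNormal (n : G) k = n * k * n⁻¹ := Subtype.ext rfl
    rw [conjMonoidAlgebra_of, hconj, ← map_mul, ← map_mul, inv_mul_cancel_right]
  | add a b ha hb => rw [map_add, mul_add, add_mul, ha, hb]
  | smul c a ha => rw [map_smul, mul_smul_comm, smul_mul_assoc, ha]

theorem conjMonoidAlgebra_eq_self {y : MonoidAlgebra K N} (hy : y ∈ Subring.center _) (n : N) :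
    conjMonoidAlgebra K N n y = y := by
  have hunit : IsUnit (MonoidAlgebra.of K N n) := (Group.isUnit n).map _
  exact hunit.mul_right_cancel <| by
    rw [conjMonoidAlgebra_mul_of, Subring.mem_center_iff.1 hy]

end Conj

variable {ρ N}

theorem asAlgebraHom_eq_one_of_isCentrallyPrimitive [CharZero K] [FiniteDimensional K V]
    [N.Normal] [N.FiniteIndex] (hirr : ρ.IsIrreducible)
    (hdim : N.index.Coprime (Module.finrank K V)) {e : MonoidAlgebra K N}
    (he : IsCentrallyPrimitive e) (he0 : Representation.asAlgebraHom (ρ.comp N.subtype) e ≠ 0) :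
    Representation.asAlgebraHom (ρ.comp N.subtype) e = 1 := by
  set Θ := Representation.asAlgebraHom (ρ.comp N.subtype)
  let _ : MulAction G (MonoidAlgebra K N) := MulAction.compHom _ (conjMonoidAlgebra K N)
  let ι := MulAction.orbit G e
  have hprim (i : ι) : IsCentrallyPrimitive (i : MonoidAlgebra K N) := by
    obtain ⟨_, g, rfl⟩ := i
    exact he.map_ringEquiv (conjMonoidAlgebra K N g).toRingEquiv
  have hstab : N ≤ MulAction.stabilizer G e := fun n hn ↦
    conjMonoidAlgebra_eq_self N he.mem_center ⟨n, hn⟩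
  have hcard : Nat.card ι ∣ N.index := by
    rw [Nat.card_coe_set_eq, ← MulAction.index_stabilizer]
    exact Subgroup.index_dvd_of_le hstab
  have : Finite ι := Nat.finite_of_card_ne_zero
    (ne_zero_of_dvd_ne_zero Subgroup.FiniteIndex.index_ne_zero hcard)
  let _ := Fintype.ofFinite ι
  let u (i : ι) : Module.End K V := Θ i
  have hu : OrthogonalIdempotents u := by
    refine ⟨fun i ↦ (hprim i).isIdempotentElem.map Θ, fun i j hij ↦ ?_⟩
    change Θ i * Θ j = 0
    rw [← map_mul, (hprim i).mul_eq_zero_of_ne (hprim j) (Subtype.coe_ne_coe.2 hij), map_zero]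
  have hρ (g : G) (i : ι) : ρ g * u i = u (g • i) * ρ g := mul_asAlgebraHom_eq ρ N g i
  let i₀ : ι := ⟨e, MulAction.mem_orbit_self e⟩
  have hsum := sum_eq_one_of_orthogonalIdempotents hirr hu hρ (i := i₀) he0
  have hfinrank := finrank_eq_card_mul_finrank_range hu.idem hsum hρ i₀
  have hone : Nat.card ι = 1 := Nat.eq_one_of_dvd_coprimes hdim hcard
    (Nat.card_eq_fintype_card (α := ι) ▸ Dvd.intro _ hfinrank.symm)
  have := (Nat.card_eq_one_iff_unique.1 hone).1
  rwa [Fintype.sum_subsingleton _ i₀] at hsum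

end GroupAlgebra

section Quasisplit

universe u v

variable {K : Type u} {G : Type v} {V : Type*} [Field K] [CharZero K] [Group G] [AddCommGroup V]
  [Module K V] [FiniteDimensional K V] {ρ : Representation K G V} {N : Subgroup G} [N.Normal]

theorem exists_matrix_algHom_of_isQuasisplit [N.FiniteIndex] (hirr : ρ.IsIrreducible)
    (hdim : N.index.Coprime (Module.finrank K V)) (hN : IsQuasisplit K (MonoidAlgebra K N)) :
    ∃ (F : Type (max u v)) (_ : Field F) (_ : Algebra K F) (r : ℕ) (_ : NeZero r)
      (Ψ : Matrix (Fin r) (Fin r) F →ₐ[K] Module.End K V), Function.Injective Ψ ∧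
        Ψ.range = (Representation.asAlgebraHom (ρ.comp N.subtype)).range := by
  have := nontrivial_of_isIrreducible hirr
  obtain ⟨-, n, F, r, _, _, _, ⟨Φ⟩⟩ := hN
  set Θ := Representation.asAlgebraHom (ρ.comp N.subtype)
  let ε (i : Fin n) : Π i, Matrix (Fin (r i)) (Fin (r i)) (F i) := Pi.single i 1
  have hsum : ∑ i, Θ (Φ.symm (ε i)) = 1 := by
    have hε : ∑ i, ε i = 1 := Finset.univ_sum_single 1
    rw [← map_sum, ← map_sum, hε, map_one, map_one]
  obtain ⟨i, -, hi⟩ := Finset.exists_ne_zero_of_sum_ne_zero (hsum.trans_ne one_ne_zero)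
  have hone : Θ (Φ.symm (ε i)) = 1 := asAlgebraHom_eq_one_of_isCentrallyPrimitive hirr hdim
    ((isCentrallyPrimitive_single (F := F) i).map_ringEquiv Φ.symm.toRingEquiv) hi
  obtain ⟨Ψ, hΨ⟩ := exists_algHom_of_map_single_eq_one (Θ.comp Φ.symm.toAlgHom) hone
  refine ⟨F i, _, _, r i, inferInstance, Ψ, Ψ.toRingHom.injective, le_antisymm ?_ ?_⟩
  · rintro _ ⟨x, rfl⟩
    exact ⟨Φ.symm (Pi.single i x), (hΨ _).trans (by rw [Pi.single_eq_same]; rfl)⟩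
  · rintro _ ⟨y, rfl⟩
    exact ⟨Φ y i, (hΨ _).symm.trans (congrArg Θ (Φ.symm_apply_apply y))⟩

end Quasisplit

section Dichotomy

theorem exists_orderOf_pow_eq_prime {M : Type*} [Monoid M] {ℓ m : ℕ} (hℓ : ℓ.Prime) {β : M}
    (hpow : β ^ ℓ ^ m = 1) (hβ : β ≠ 1) : ∃ k, orderOf (β ^ k) = ℓ := by
  obtain ⟨j, -, hj⟩ := (Nat.dvd_prime_pow hℓ).1 (orderOf_dvd_of_pow_eq_one hpow)
  have hj0 : j ≠ 0 := by
    rintro rfl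
    exact hβ (orderOf_eq_one_iff.1 hj)
  have hne : orderOf β ≠ 0 := hj ▸ pow_ne_zero j hℓ.ne_zero
  exact ⟨_, orderOf_pow_orderOf_div hne (hj ▸ dvd_pow_self ℓ hj0)⟩

theorem exists_pow_mem_and_forall_eq_pow_mul {G : Type*} [Group G] [Finite G] (N : Subgroup G)
    [N.Normal] [hcyc : IsCyclic (G ⧸ N)] :
    ∃ γ : G, γ ^ N.index ∈ N ∧ ∀ g, ∃ k : ℕ, ∃ n ∈ N, g = γ ^ k * n := by
  obtain ⟨γ', hγ'⟩ := hcyc.exists_generator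
  obtain ⟨γ, rfl⟩ := QuotientGroup.mk_surjective γ'
  refine ⟨γ, N.pow_index_mem γ, fun g ↦ ?_⟩
  obtain ⟨k, hk⟩ := mem_powers_iff_mem_zpowers.2 (hγ' g)
  exact ⟨k, (γ ^ k)⁻¹ * g, QuotientGroup.eq.1 hk, (mul_inv_cancel_left _ _).symm⟩

variable {K G V : Type*} [Field K] [Group G] [AddCommGroup V] [Module K V]
  {ρ : Representation K G V} {N : Subgroup G}

theorem asAlgebraHom_apply_mem {W : Submodule K V} (hW : ∀ g, ∀ x ∈ W, ρ g x ∈ W)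
    (y : MonoidAlgebra K G) {x : V} (hx : x ∈ W) : ρ.asAlgebraHom y x ∈ W := by
  induction y using MonoidAlgebra.induction_on with
  | of g => rw [Representation.asAlgebraHom_of]; exact hW g x hx
  | add a b ha hb => rw [map_add]; exact W.add_mem ha hb
  | smul c a ha => rw [map_smul]; exact W.smul_mem c ha

theorem isIrreducible_restrict_of_mem_range (hirr : ρ.IsIrreducible) {γ : G}
    (hgen : ∀ g, ∃ k : ℕ, ∃ n ∈ N, g = γ ^ k * n)
    (hγ : ρ γ ∈ (Representation.asAlgebraHom (ρ.comp N.subtype)).range) :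
    Representation.IsIrreducible (ρ.comp N.subtype) := by
  have := nontrivial_of_isIrreducible hirr
  refine isIrreducible_of_forall_stable fun W hW ↦ eq_bot_or_eq_top_of_stable hirr fun g x hx ↦ ?_
  obtain ⟨k, n, hn, rfl⟩ := hgen g
  obtain ⟨y, hy : Representation.asAlgebraHom (ρ.comp N.subtype) y = ρ γ⟩ := hγ
  rw [map_mul, map_pow, ← hy, ← map_pow]
  exact asAlgebraHom_apply_mem hW _ (hW ⟨n, hn⟩ x hx)

theorem isIrreducible_restrict_or_exists_orderOf_eq [CharZero K] [FiniteDimensional K V] [Finite G]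
    [N.Normal] [IsCyclic (G ⧸ N)] (hirr : ρ.IsIrreducible)
    (hN : IsQuasisplit K (MonoidAlgebra K N)) {ℓ m : ℕ} (hℓ : ℓ.Prime) (hindex : N.index = ℓ ^ m)
    (hdim : ¬ ℓ ∣ Module.finrank K V) :
    Representation.IsIrreducible (ρ.comp N.subtype) ∨
      ℓ ∣ Nat.card G ∧ ∃ z : Module.End K V, (∀ g, Commute z (ρ g)) ∧ orderOf z = ℓ := by
  obtain ⟨F, _, _, r, _, Ψ, hΨ, hrange⟩ := exists_matrix_algHom_of_isQuasisplit hirr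
    (hindex ▸ Nat.Coprime.pow_left m (hℓ.coprime_iff_not_dvd.2 hdim)) hN
  obtain ⟨γ, hγ, hgen⟩ := exists_pow_mem_and_forall_eq_pow_mul N
  have hNΨ (n : G) (hn : n ∈ N) : ρ n ∈ Ψ.range :=
    hrange ▸ ⟨MonoidAlgebra.of K N ⟨n, hn⟩, Representation.asAlgebraHom_of _ _⟩
  have hnormalizes (x) : ∃ y, ρ γ * Ψ x = Ψ y * ρ γ := by
    obtain ⟨x', hx'⟩ : Ψ x ∈ (Representation.asAlgebraHom (ρ.comp N.subtype)).range :=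
      hrange ▸ ⟨x, rfl⟩
    obtain ⟨y, hy⟩ : Representation.asAlgebraHom (ρ.comp N.subtype) (conjMonoidAlgebra K N γ x') ∈
      Ψ.range := hrange ▸ ⟨_, rfl⟩
    exact ⟨y, hx' ▸ hy ▸ mul_asAlgebraHom_eq ρ N γ x'⟩
  obtain ⟨x, β, hγβ, hβ, hcomm⟩ := exists_eq_mul_of_normalizes_range hΨ hℓ hdim
    (ρ.toHomUnits γ) hnormalizes (m := m) (by
      obtain ⟨y, hy : Ψ y = _⟩ := hNΨ _ hγ
      exact ⟨y, by rw [hy, hindex, map_pow]; rfl⟩)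
  replace hγβ : ρ γ = Ψ x * β := hγβ
  by_cases hβ1 : β = 1
  · refine .inl (isIrreducible_restrict_of_mem_range hirr hgen (hrange ▸ ⟨x, ?_⟩))
    rw [hγβ, hβ1, mul_one]; rfl
  · obtain ⟨k, hk⟩ := exists_orderOf_pow_eq_prime hℓ hβ hβ1
    have hm : m ≠ 0 := by
      rintro rfl
      exact hβ1 (by rwa [pow_zero, pow_one] at hβ)
    have hcard : ℓ ∣ Nat.card G := (dvd_pow_self ℓ hm).trans (hindex ▸ N.index_dvd_card)
    refine .inr ⟨hcard, β ^ k, fun g ↦ Commute.pow_left ?_ k, hk⟩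
    obtain ⟨j, n, hn, rfl⟩ := hgen g
    obtain ⟨y, hy : Ψ y = _⟩ := hNΨ n hn
    rw [map_mul, map_pow, ← hy, hγβ]
    exact (((hcomm x).mul_right (Commute.refl β)).pow_right j).mul_right (hcomm y)

end Dichotomy

theorem isUnit_natCast_of_coprime {O : Type*} [CommRing O] [IsLocalRing O] {a b : ℕ}
    (hab : a.Coprime b) (hb : ¬ IsUnit (b : O)) : IsUnit (a : O) := by
  obtain ⟨x, y, hxy⟩ : IsCoprime (a : O) (b : O) := hab.cast
  exact isUnit_of_mul_isUnit_right ((IsLocalRing.isUnit_or_isUnit_of_add_one hxy).resolve_right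
    fun h ↦ hb (isUnit_of_mul_isUnit_right h))

theorem hasUnimodularLattice_of_satisfiesDVia {O K G V : Type*} [CommRing O] [IsDomain O]
    [IsDiscreteValuationRing O] [Field K] [CharZero K] [Algebra O K] [IsFractionRing O K]
    [AddCommGroup V] [Module K V] [FiniteDimensional K V] [Module O V] [IsScalarTower O K V]
    [Group G] {ρ : Representation K G V} {N : Subgroup G} [N.Normal] {ϖ : O} (hϖ : Irreducible ϖ)
    [IsAdicComplete (Ideal.span {ϖ}) O] {ℓ d e : ℕ} (he : Associated (ℓ : O) (ϖ ^ e)) (he0 : e ≠ 0)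
    (hG : SatisfiesDVia ℓ G N) (hN : IsQuasisplit K (MonoidAlgebra K N))
    (hirr : ρ.IsIrreducible) (hfaithful : Function.Injective ρ) (hsymp : IsSymplecticRep ρ)
    (hV : Module.finrank K V = 2 * d) (hlt : d * e + 1 < ℓ) : HasUnimodularLattice O ρ := by
  obtain ⟨f, hf, halt, hinv⟩ := hsymp
  have := hG.finite
  have := hG.isCyclic
  have := Fact.mk hG.prime
  have := nontrivial_of_isIrreducible hirr
  obtain ⟨m, hindex⟩ := IsPGroup.iff_card.1 hG.isPGroup
  have hd0 : 0 < d := by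
    have := Module.finrank_pos (R := K) (M := V)
    lia
  have hdℓ : d + 1 < ℓ := by
    have := Nat.le_mul_of_pos_right d (Nat.pos_of_ne_zero he0)
    lia
  have hodd : Odd ℓ := hG.prime.odd_of_ne_two (by lia)
  have hdim : ¬ ℓ ∣ Module.finrank K V := by
    rw [hV, (Nat.coprime_two_right.2 hodd).dvd_mul_left]
    exact Nat.not_dvd_of_pos_of_lt hd0 (by lia)
  have hℓunit : ¬ IsUnit (ℓ : O) := by
    rw [he.isUnit_iff, isUnit_pow_iff he0]
    exact hϖ.not_isUnit
  rcases isIrreducible_restrict_or_exists_orderOf_eq hirr hN hG.prime hindex hdim with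
    hirrN | ⟨hcard, z, hz, horder⟩
  · exact hasUnimodularLattice_of_isIrreducible_restrict hϖ hf halt hinv
      (isUnit_natCast_of_coprime hG.coprime hℓunit) hirrN
  · exact hasUnimodularLattice_of_commute_of_orderOf_eq hirr hfaithful hf halt hinv hϖ hG.prime
      hodd he0 hV he hlt hcard hz horder

theorem theorem4p2
    -- `K` is a complete discrete valuation field with normalized valuation (the additive value `n`
    -- is written `exp (-n)`), of characteristic zero and residue characteristic `ℓ`, `e = e(K)`
    {K : Type*} [Field K] [CharZero K] [Valued K ℤᵐ⁰] [CompleteSpace K]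
    (hv : Function.Surjective (Valued.v : Valuation K ℤᵐ⁰))
    (ℓ : ℕ) [CharP (IsLocalRing.ResidueField (Valued.v : Valuation K ℤᵐ⁰).valuationSubring) ℓ]
    (e : ℕ) (he : (Valued.v : Valuation K ℤᵐ⁰) (ℓ : K) = WithZero.exp (-(e : ℤ)))
    -- `G` satisfies `(D_ℓ)`, and `K[N]` is quasisplit
    {G : Type*} [Group G] (N : Subgroup G) [N.Normal] (hG : SatisfiesDVia ℓ G N)
    (hN : IsQuasisplit K (MonoidAlgebra K N))
    -- `V` is a `2d`-dimensional faithful simple symplectic `K[G]`-module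
    {V : Type*} [AddCommGroup V] [Module K V] [FiniteDimensional K V]
    (d : ℕ) (hd : Module.finrank K V = 2 * d)
    (ρ : Representation K G V) (hfaithful : Function.Injective ρ)
    (hsimple : ρ.IsIrreducible) (hsymp : IsSymplecticRep ρ)
    (hℓ : d * e + 1 < ℓ) :
    ∃ (T : Submodule (Valued.v : Valuation K ℤᵐ⁰).valuationSubring V)
      (_ : Submodule.IsLattice K T)
      (hT : ∀ (g : G), ∀ x ∈ T, ρ g x ∈ T)
      (f' : LinearMap.BilinForm (Valued.v : Valuation K ℤᵐ⁰).valuationSubring T),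
      f'.IsPerfPair ∧ f'.IsAlt ∧
        ∀ (g : G) (x y : T),
          f' ⟨ρ g x, hT g x x.2⟩ ⟨ρ g y, hT g y y.2⟩ = f' x y := by
  obtain ⟨_, ϖ, hϖ, hvϖ⟩ := exists_isUniformizer_of_surjective hv
  have := isAdicComplete_valuationSubring hϖ.ne_zero (by rw [hvϖ]; decide)
  have hℓϖ : Associated (ℓ : (Valued.v : Valuation K ℤᵐ⁰).valuationSubring) (ϖ ^ e) := by
    refine associated_of_valuation_eq ?_
    rw [SubmonoidClass.coe_pow, map_pow, hvϖ, ← WithZero.exp_nsmul]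
    simpa using he
  have he0 : e ≠ 0 := by
    rintro rfl
    rw [pow_zero, associated_one_iff_isUnit, ← IsLocalRing.residue_ne_zero_iff_isUnit,
      map_natCast, CharP.cast_eq_zero] at hℓϖ
    exact hℓϖ rfl
  exact hasUnimodularLattice_of_satisfiesDVia hϖ hℓϖ he0 hG hN hsimple hfaithful hsymp hd hℓ
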